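/- **Setting.** Let $\Phi$ be a reduced crystallographic root system spanning a finite-dimensional real vector space $V$ (the root system of a semisimple group $G$ over $\mathbb{Q}$), with coroots $\alpha^\vee$ in the dual space, and let $\langle\cdot,\cdot\rangle$ be the pairing of $V$ with its dual, extended complex-bilinearly. Let $\Delta=\{\alpha_1,\dots,\alpha_r\}$ be a base with positive roots $\Phi_+$, $\Phi_-=-\Phi_+$, Weyl group $W$, Dynkin diagram $\Gamma$, and fundamental weights $\lambda_j$, $\langle\lambda_j,\alpha_i^\vee\rangle=\delta_{ij}$. Put $\rho=\frac12\sum_{\alpha\in\Phi_+}\alpha$, $\operatorname{ht}\alpha^\vee=\langle\rho,\alpha^\vee\rangle$, $\Phi_w=\Phi_+\cap w^{-1}\Phi_-$ and $\xi(s)=\pi^{-s/2}\Gamma(s/2)\zeta(s)$, where $\zeta$ is the Riemann zeta function. For $\lambda\in V\otimes\mathbb{C}$ and $T$ in the dual of $V$ let $$\omega^G_{\mathbb Q}(\lambda;T)=\sum_{w\in W}e^{\langle w\lambda-\rho,T\rangle}\prod_{\alpha\in\Delta}\frac1{\langle w\lambda-\rho,\alpha^\vee\rangle}\prod_{\alpha\in\Phi_w}\frac{\xi(\langle\lambda,\alpha^\vee\rangle)}{\xi(\langle\lambda,\alpha^\vee\rangle+1)}.$$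 Fix a simple root $\alpha_p$ (it corresponds to a maximal parabolic subgroup $P$ of $G$), let $\Delta_p=\Delta\setminus\{\alpha_p\}=\{\beta_1,\dots,\beta_{r-1}\}$ (in any order), let $\rho_p$ be half the sum of those $\alpha\in\Phi_+$ with $\langle\lambda_p,\alpha^\vee\rangle=0$, and put $c_p=2\langle\lambda_p-\rho_p,\alpha_p^\vee\rangle$. In the coordinates $\lambda=\rho+\sum_k s_k\lambda_k$, with $s=s_p$, define $$\omega^{G/P}_{\mathbb Q}(s;T)=\operatorname{Res}_{\langle\lambda-\rho,\beta_1^\vee\rangle=0}\cdots\operatorname{Res}_{\langle\lambda-\rho,\beta_{r-1}^\vee\rangle=0}\ \omega^G_{\mathbb Q}(\lambda;T).$$ This is a sum over the $w\in W$ with $\Delta_p\subset w^{-1}(\Delta\cup\Phi_-)$ of terms, each of which is an exponential times a rational function times $$\prod_{\alpha\in\Phi_w\setminus\Delta_p}\xi(\langle\lambda_p,\alpha^\vee\rangle s+\operatorname{ht}\alpha^\vee)\prod_{\alpha\in\Phi_w}\xi(\langle\lambda_p,\alpha^\vee\rangle s+\operatorname{ht}\alpha^\vee+1)^{-1}.$$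 For $(k,h)\in\mathbb{Z}^2$ let $m_p(k,h)\ge 0$ be the least integer such that multiplication by $\xi(ks+h)^{m_p(k,h)}$ cancels, formally, the factors $\xi(ks+h)$ in the denominators of all these terms. Weng's zeta function is the meromorphic function $$\xi^{G/P}_{\mathbb Q;o}(s;T)=\omega^{G/P}_{\mathbb Q}(s;T)\prod_{(k,h)}\xi(ks+h)^{m_p(k,h)},$$ and its normalization is $\xi^{G/P}_{\mathbb Q}(s)=\xi^{G/P}_{\mathbb Q;o}\bigl(s-\tfrac{c_p+1}{2};0\bigr)$. **Theorem (Functional equations).** The function $\xi^{G/P}_{\mathbb Q}(s)$ is meromorphic on $\mathbb{C}$ and satisfies $$\xi^{G/P}_{\mathbb Q}(1-s)=\xi^{G/P}_{\mathbb Q}(s).$$ Moreover, for every $q$ in the $\operatorname{Aut}(\Gamma)$-orbit of $p$, with corresponding maximal parabolic subgroup $Q$, $$\xi^{G/P}_{\mathbb Q}(s)=\xi^{G/Q}_{\mathbb Q}(s),$$ for any choice of the orderings of $\Delta_p$ and $\Delta_q$ in the definitions. These are identities of meromorphic functions of $s\in\mathbb{C}$. -/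

import Mathlib

open scoped TensorProduct Topology

noncomputable section

namespace WengZeta

/-- The residue at `a` of a function of one complex variable,
`Res_{z = a} f = (1 / 2πi) ∮_{|z - a| = R} f(z) dz` for all sufficiently small `R > 0`. -/
def residue (f : ℂ → ℂ) (a : ℂ) : ℂ :=
  Filter.limUnder (𝓝[>] (0 : ℝ)) fun R : ℝ =>
    (2 * (Real.pi : ℂ) * Complex.I)⁻¹ * ∮ z in C(a, R), f z

open scoped Classical in
/-- Iterated residues of a function of several complex variables `(s_k)_{k ∈ I}`:
`iteratedResidue [k₁, …, kₙ] F = Res_{s_{k₁} = 0} ⋯ Res_{s_{kₙ} = 0} F`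
(the residue in the last variable of the list is taken first). The result is a function of the
variables that are not in the list. -/
def iteratedResidue {I : Type*} : List I → ((I → ℂ) → ℂ) → (I → ℂ) → ℂ
  | [], F, s => F s
  | k :: L, F, s => residue (fun z => iteratedResidue L F (Function.update s k z)) 0

variable {ι V V' : Type*} [AddCommGroup V] [Module ℝ V]
  [AddCommGroup V'] [Module ℝ V'] {P : RootPairing ι ℝ V V'} [P.IsRootSystem]

/-- The Weyl group of a (finite) root system is finite. -/
instance finite_weylGroup [Finite ι] : Finite P.weylGroup := by
  refine Finite.of_injective (fun w : P.weylGroup => (P.weylGroupToPerm w)) ?_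
  intro w w' h
  apply Subtype.ext
  apply RootPairing.Equiv.weightHom_injective P
  apply LinearEquiv.toLinearMap_injective
  refine LinearMap.ext_on_range (v := P.root) (by simp) fun i => ?_
  have h1 := P.weylGroup_apply_root w i
  have h2 := P.weylGroup_apply_root w' i
  have h3 : P.weylGroupToPerm w = P.weylGroupToPerm w' := h
  rw [h3, ← h2] at h1
  exact h1

instance fintypeWeylGroup [Finite ι] : Fintype P.weylGroup := Fintype.ofFinite _

/-- The complex-bilinear extension of the pairing between `V` and its dual `V'`:
`⟨x, y⟩` for `x ∈ V_ℂ = ℂ ⊗ V` and `y ∈ V'`. -/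
def pairC (P : RootPairing ι ℝ V V') (x : ℂ ⊗[ℝ] V) (y : V') : ℂ :=
  TensorProduct.AlgebraTensorModule.rid ℝ ℂ ℂ ((P.toLinearMap.flip y).baseChange ℂ x)

/-- The action of the Weyl group on `V_ℂ = ℂ ⊗ V`. -/
def weylC (w : P.weylGroup) (x : ℂ ⊗[ℝ] V) : ℂ ⊗[ℝ] V :=
  (P.weylGroupRootRep w).baseChange ℂ x

/-- The fundamental weight `λ_j`, determined by `⟨λ_j, α_i^∨⟩ = δ_{ij}`
(see `pairing_fundamentalWeight`). -/
def fundamentalWeight (b : P.Base) (j : b.support) : V :=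
  P.toLinearMap.toPerfPair.symm (b.toCoweightBasis.coord j)

open scoped Classical in
theorem pairing_fundamentalWeight (b : P.Base) (i j : b.support) :
    P.toLinearMap (fundamentalWeight b j) (P.coroot i) = if i = j then 1 else 0 := by
  simp [fundamentalWeight, Finsupp.single_apply]

variable [Fintype ι]

open scoped Classical in
/-- The Weyl vector: half the sum of the positive roots. -/
def weylVector (b : P.Base) : V :=
  (1 / 2 : ℝ) • ∑ i : ι with b.IsPos i, P.root i

/-- The height `Ht α^∨ = ⟨ρ, α^∨⟩` of a coroot. -/
def coheight (b : P.Base) (i : ι) : ℝ := P.toLinearMap (weylVector b) (P.coroot i)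

open scoped Classical in
/-- The set `Φ_w = Φ₊ ∩ w⁻¹ Φ₋`. -/
def inversions (b : P.Base) (w : P.weylGroup) : Finset ι :=
  {i : ι | b.IsPos i ∧ ¬ b.IsPos (w • i)}

/-- The period `ω^G(λ; T)`, for `λ ∈ V_ℂ` and `T ∈ V'`; here
`completedRiemannZeta s = π^(-s/2) Γ(s/2) ζ(s)`. -/
def period (b : P.Base) (x : ℂ ⊗[ℝ] V) (T : V') : ℂ :=
  ∑ w : P.weylGroup,
    Complex.exp (pairC P (weylC w x - 1 ⊗ₜ weylVector b) T) *
      (∏ i ∈ b.support, 1 / pairC P (weylC w x - 1 ⊗ₜ weylVector b) (P.coroot i)) *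
      ∏ i ∈ inversions b w,
        completedRiemannZeta (pairC P x (P.coroot i)) /
          completedRiemannZeta (pairC P x (P.coroot i) + 1)

/-- The coordinates `λ = ρ + ∑ s_k λ_k`, that is `s_k = ⟨λ - ρ, α_k^∨⟩`. -/
def fromCoords (b : P.Base) (s : b.support → ℂ) : ℂ ⊗[ℝ] V :=
  1 ⊗ₜ weylVector b + ∑ k, s k ⊗ₜ fundamentalWeight b k

/-- The list `l` is an ordering of `Δ_p = Δ ∖ {α_p}`. -/
def IsOrdering (b : P.Base) (p : b.support) (l : List b.support) : Prop :=
  l.Nodup ∧ ∀ k, k ∈ l ↔ k ≠ p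

open scoped Classical in
/-- `ω^{G/P}(s; T)`: the iterated residue of the period along `⟨λ - ρ, β^∨⟩ = 0` for
`β ∈ Δ_p`, in the order prescribed by `l`, as a function of `s = ⟨λ - ρ, α_p^∨⟩`. -/
def residualPeriod (b : P.Base) (p : b.support) (l : List b.support) (T : V') (s : ℂ) : ℂ :=
  iteratedResidue l (fun t => period b (fromCoords b t) T) (Pi.single p s)

/-- The condition `Δ_p ⊆ w⁻¹ (Δ ∪ Φ₋)`, which singles out the elements `w` of the Weyl group that
contribute to `ω^{G/P}`. -/
def Admissible (b : P.Base) (p : b.support) (w : P.weylGroup) : Prop :=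
  ∀ k : b.support, k ≠ p → w • (k : ι) ∈ b.support ∨ ¬ b.IsPos (w • (k : ι))

/-- The term of `ω^{G/P}(s; T)` that belongs to an admissible `w` has the `ξ`-part
`∏_{α ∈ Φ_w ∖ Δ_p} ξ(⟨λ_p, α^∨⟩ s + Ht α^∨) / ∏_{α ∈ Φ_w} ξ(⟨λ_p, α^∨⟩ s + Ht α^∨ + 1)`.
This is the number of times that `ξ(k s + h)` occurs in the numerator. -/
def numCount (b : P.Base) (p : b.support) (w : P.weylGroup) (k h : ℤ) : ℕ :=
  Set.ncard {i : ι | i ∈ inversions b w ∧ ¬ (i ∈ b.support ∧ i ≠ p) ∧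
    P.toLinearMap (fundamentalWeight b p) (P.coroot i) = k ∧ coheight b i = h}

/-- The number of times that `ξ(k s + h)` occurs in the denominator of the term of
`ω^{G/P}(s; T)` that belongs to `w`; see `numCount`. -/
def denCount (b : P.Base) (p : b.support) (w : P.weylGroup) (k h : ℤ) : ℕ :=
  Set.ncard {i : ι | i ∈ inversions b w ∧
    P.toLinearMap (fundamentalWeight b p) (P.coroot i) = k ∧ coheight b i + 1 = h}

/-- The minimal number of factors `ξ(k s + h)` by which one has to multiply in order to cancel
`ξ(k s + h)` from the denominators of all the terms of `ω^{G/P}(s; T)`. -/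
def minimalExponent (b : P.Base) (p : b.support) (k h : ℤ) : ℕ :=
  sInf {m : ℕ | ∀ w : P.weylGroup, Admissible b p w → denCount b p w k h ≤ numCount b p w k h + m}

/-- The minimal `ξ`-factor `∏ ξ(k s + h)^{m(k, h)}` (all but finitely many exponents vanish). -/
def minimalFactor (b : P.Base) (p : b.support) (s : ℂ) : ℂ :=
  ∏ᶠ kh : ℤ × ℤ, completedRiemannZeta (kh.1 * s + kh.2) ^ minimalExponent b p kh.1 kh.2

/-- The pointwise expression for `ξ^{G/P}_o(s; T)`: the product of `ω^{G/P}(s; T)` with the minimal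
`ξ`-factor. At isolated points (poles and removable singularities of the terms) its value is not
meaningful. -/
def zetaExpr (b : P.Base) (p : b.support) (l : List b.support) (T : V') (s : ℂ) : ℂ :=
  residualPeriod b p l T s * minimalFactor b p s

/-- Weng's zeta function `ξ^{G/P}_o(s; T)` as a meromorphic function of `s ∈ ℂ`: removable
singularities are removed, and the value at a pole is `0`. -/
def zetaO (b : P.Base) (p : b.support) (l : List b.support) (T : V') : ℂ → ℂ :=
  toMeromorphicNFOn (zetaExpr b p l T) Set.univ

open scoped Classical in
/-- Half the sum of the positive roots of `Φ_p`, the root system normal to `λ_p`. -/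
def weylVectorAt (b : P.Base) (p : b.support) : V :=
  (1 / 2 : ℝ) • ∑ i : ι with
    b.IsPos i ∧ P.toLinearMap (fundamentalWeight b p) (P.coroot i) = 0, P.root i

/-- The constant `c_p = 2 ⟨λ_p - ρ_p, α_p^∨⟩`. -/
def centerConst (b : P.Base) (p : b.support) : ℝ :=
  2 * P.toLinearMap (fundamentalWeight b p - weylVectorAt b p) (P.coroot p)

/-- The normalized zeta function `ξ^{G/P}(s) = ξ^{G/P}_o(s - (c_p + 1) / 2; 0)`. -/
def zeta (b : P.Base) (p : b.support) (l : List b.support) (s : ℂ) : ℂ :=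
  zetaO b p l 0 (s - ((centerConst b p : ℂ) + 1) / 2)

/-- The group `Aut(Γ)` of automorphisms of the Dynkin diagram, as a group of permutations of the
simple roots: the permutations that preserve the Cartan matrix. -/
def dynkinAut [P.IsCrystallographic] (b : P.Base) : Subgroup (Equiv.Perm b.support) where
  carrier := {e | ∀ i j, b.cartanMatrix (e i) (e j) = b.cartanMatrix i j}
  one_mem' := fun _ _ => rfl
  mul_mem' := fun {e f} he hf i j => (he (f i) (f j)).trans (hf i j)
  inv_mem' := fun {e} he i j => by
    have h := he (e⁻¹ i) (e⁻¹ j)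
    simpa using h.symm

end WengZeta

end

/-! For generic `s`, near `λ = ρ + s λ_p` each term of the period is a holomorphic function times a
squarefree product of inverse coordinates `t_k`, `k ≠ p`. The iterated residue therefore keeps
exactly the terms with a pole in every one of these coordinates, those of the admissible `w`, and is
an explicit finite sum independent of the order (`residualPeriod_eq`).

Let `w₀`, `w₁` be the longest elements of `W` and of the stabilizer of `λ_p`. The involution `w ↦ w₀
w w₁` preserves admissibility. With `s ↦ -c_p - s` and `ξ(1 - z) = ξ(z)`, it multiplies every term
by one factor `U(s)`, the product of `ξ(x + 1) / ξ(x)` over the positive roots of nonzero level,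
where `x = ⟨λ, α^∨⟩` (`residueTerm_mul`). Complementation of inversions shows that the minimal
factor `M` satisfies `M(-c_p - s) U(s) = M(s)` (`minimalFactor_mul_unipotentFactor`), so the product
is invariant.

A diagram automorphism extends to an automorphism of the root system. It preserves heights, carries
levels for `p` to levels for its image, and acts on the Weyl group by conjugation, so all
ingredients for `p` and `q` agree. The identities hold off discrete sets, and meromorphic normal
forms extend them to all points. -/

noncomputable section

namespace WengZeta

/-! ### Weyl group actions, negation and positivity of roots -/

section RootCombinatorics

variable {ι V V' : Type*} [AddCommGroup V] [Module ℝ V]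
  [AddCommGroup V'] [Module ℝ V'] {P : RootPairing ι ℝ V V'}

/-- Automorphisms of a root system preserve the pairing of weights with coroots. -/
theorem aut_pairing (f : P.Aut) (v : V) (i : ι) :
    P.toLinearMap (f.weightMap v) (P.coroot (f.indexEquiv i)) = P.toLinearMap v (P.coroot i) := by
  have h1 := LinearMap.congr_fun
    (RootPairing.Hom.weight_coweight_transpose_apply P P (P.coroot (f.indexEquiv i)) f.toHom) v
  rw [RootPairing.Hom.coroot_coweightMap_apply, Equiv.symm_apply_apply] at h1
  simpa using h1

theorem weylGroup_pairing (w : P.weylGroup) (v : V) (i : ι) :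
    P.toLinearMap (w • v) (P.coroot (w • i)) = P.toLinearMap v (P.coroot i) :=
  aut_pairing (w : P.Aut) v i

theorem weylGroup_pairing_smul_left (w : P.weylGroup) (v : V) (i : ι) :
    P.toLinearMap (w • v) (P.coroot i) = P.toLinearMap v (P.coroot (w⁻¹ • i)) := by
  rw [← weylGroup_pairing w v, smul_inv_smul]

theorem weylGroup_smul_root (w : P.weylGroup) (i : ι) : w • P.root i = P.root (w • i) :=
  P.weylGroup_apply_root w i

theorem weylGroup_smul_real (w : P.weylGroup) (r : ℝ) (v : V) : w • r • v = r • w • v :=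
  (P.weylGroupRootRep w).map_smul r v

/-- The index of the negative of a root. -/
def negIdx (P : RootPairing ι ℝ V V') (i : ι) : ι := P.reflectionPerm i i

theorem root_negIdx (i : ι) : P.root (negIdx P i) = -P.root i := by simp [negIdx]

theorem coroot_negIdx (i : ι) : P.coroot (negIdx P i) = -P.coroot i := by
  simp [negIdx, RootPairing.coroot_reflectionPerm]

theorem negIdx_negIdx (i : ι) : negIdx P (negIdx P i) = i :=
  P.root.injective (by simp [root_negIdx])

theorem smul_negIdx (w : P.weylGroup) (i : ι) : w • negIdx P i = negIdx P (w • i) :=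
  P.root.injective (by
    rw [root_negIdx, ← weylGroup_smul_root, ← weylGroup_smul_root, root_negIdx, smul_neg])

theorem pairing_reflection_of_orth {v : V} {k : ι} (hv : P.toLinearMap v (P.coroot k) = 0) (i : ι) :
    P.toLinearMap v (P.coroot (P.reflectionPerm k i)) = P.toLinearMap v (P.coroot i) := by
  rw [RootPairing.coroot_reflectionPerm, RootPairing.coreflection_apply]
  simp [hv]

theorem pairing_negIdx (v : V) (i : ι) :
    P.toLinearMap v (P.coroot (negIdx P i)) = -P.toLinearMap v (P.coroot i) := by
  simp [coroot_negIdx]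

theorem ofIdx_smul_eq (k : ι) (v : V) :
    RootPairing.weylGroup.ofIdx P k • v = v - P.toLinearMap v (P.coroot k) • P.root k := by
  change P.reflection k v = _
  rw [RootPairing.reflection_apply]
  rfl

theorem ofIdx_smul_of_orth {v : V} {k : ι} (hv : P.toLinearMap v (P.coroot k) = 0) :
    RootPairing.weylGroup.ofIdx P k • v = v := by
  rw [ofIdx_smul_eq, hv, zero_smul, sub_zero]

variable (b : P.Base)

theorem isPos_negIdx (i : ι) : b.IsPos (negIdx P i) ↔ ¬ b.IsPos i :=
  RootPairing.Base.IsPos.neg_iff_not b i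

variable [Finite ι] [P.IsCrystallographic] [P.IsReduced]

theorem isPos_reflectionPerm {i j : ι} (hj : j ∈ b.support) (h1 : i ≠ j) (h2 : i ≠ negIdx P j) :
    b.IsPos (P.reflectionPerm j i) ↔ b.IsPos i := by
  constructor
  · intro h
    by_contra hn
    rw [← isPos_negIdx] at hn
    have h3 := hn.reflectionPerm hj (fun h => h2 (by rw [← h, negIdx_negIdx]))
    have h4 : P.reflectionPerm j (negIdx P i) = negIdx P (P.reflectionPerm j i) :=
      P.root.injective (by simp [root_negIdx])
    rw [h4, isPos_negIdx] at h3
    exact h3 h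
  · exact fun h => h.reflectionPerm hj h1

/-- `b.flip` is the base of simple coroots. Every root arises from simple ones by negation and
simple reflections, and these affect the sign of a root and of its coroot alike: a simple reflection
changes the sign of its own root and its negative only. -/
theorem isPos_flip_iff (i : ι) : b.flip.IsPos i ↔ b.IsPos i := by
  have neg (j : ι) : b.flip.IsPos (negIdx P j) ↔ ¬ b.flip.IsPos j := isPos_negIdx b.flip j
  refine b.induction_reflect i (p := fun j => b.flip.IsPos j ↔ b.IsPos j) ?_ ?_ ?_
  · intro j hj
    exact (neg j).trans (hj.not.trans (isPos_negIdx b j).symm)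
  · intro j hj
    exact iff_of_true (b.flip.isPos_of_mem_support hj) (b.isPos_of_mem_support hj)
  · intro j k hj hk
    by_cases h1 : j = k
    · subst h1
      exact (neg j).trans (hj.not.trans (isPos_negIdx b j).symm)
    by_cases h2 : j = negIdx P k
    · have h3 : P.reflectionPerm k j = k := by
        rw [h2]; exact P.root.injective (by simp [root_negIdx])
      rw [h3]
      exact iff_of_true (b.flip.isPos_of_mem_support hk) (b.isPos_of_mem_support hk)
    · exact (isPos_reflectionPerm b.flip hk h1 h2).trans
        (hj.trans (isPos_reflectionPerm b hk h1 h2).symm)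

end RootCombinatorics

/-! ### Heights of coroots and longest elements of stabilizers -/

section LongestElements

variable {ι V V' : Type*} [Fintype ι] [AddCommGroup V] [Module ℝ V]
  [AddCommGroup V'] [Module ℝ V'] {P : RootPairing ι ℝ V V'}
  [P.IsCrystallographic] [P.IsReduced] (b : P.Base)

theorem exists_coroot_eq_sum (i : ι) : ∃ f : b.support → ℤ,
    ((b.IsPos i ∧ ∀ k, 0 ≤ f k) ∨ (¬ b.IsPos i ∧ ∀ k, f k ≤ 0)) ∧
      P.coroot i = ∑ k, f k • P.coroot k := by
  obtain ⟨f, -, hf, h⟩ := b.flip.exists_root_eq_sum_int i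
  have hh := RootPairing.Base.height_eq_sum h
  have hne := b.flip.height_ne_zero i
  refine ⟨fun k => f k, ?_, ?_⟩
  · rw [← isPos_flip_iff, RootPairing.Base.isPos_iff]
    rcases hf with hf | hf
    · refine Or.inl ⟨?_, fun k => hf.le _⟩
      have : 0 ≤ b.flip.height i := by rw [hh]; exact Finset.sum_nonneg fun k _ => hf.le k
      lia
    · refine Or.inr ⟨?_, fun k => hf.le _⟩
      have : b.flip.height i ≤ 0 := by rw [hh]; exact Finset.sum_nonpos fun k _ => hf.le k
      lia
  · have h' : P.coroot i = ∑ j ∈ b.support, f j • P.coroot j := h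
    rw [h', Finset.sum_coe_sort b.support (fun j => f j • P.coroot j)]

open scoped Classical in
/-- Half the sum of the positive roots whose coroots are orthogonal to `v`. -/
def weylVectorOrth (v : V) : V :=
  (1 / 2 : ℝ) • ∑ i : ι with b.IsPos i ∧ P.toLinearMap v (P.coroot i) = 0, P.root i

/-- The reflection in `k` permutes the other roots in the sum and negates their pairings with `k`,
so these cancel. Only `k` itself is left, with pairing 2. -/
theorem pairing_weylVectorOrth {v : V} {k : ι} (hk : k ∈ b.support)
    (hv : P.toLinearMap v (P.coroot k) = 0) :
    P.toLinearMap (weylVectorOrth b v) (P.coroot k) = 1 := by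
  classical
  set S : Finset ι := {i | b.IsPos i ∧ P.toLinearMap v (P.coroot i) = 0} with hS
  have hkS : k ∈ S := by simp [hS, hv, b.isPos_of_mem_support hk]
  have h0 : ∑ i ∈ S.erase k, P.pairing i k = 0 := by
    have hmem : ∀ i ∈ S.erase k, P.reflectionPerm k i ∈ S.erase k := by
      intro i hi
      simp only [hS, Finset.mem_erase, Finset.mem_filter, Finset.mem_univ, true_and] at hi ⊢
      have h2 := hi.2.1.reflectionPerm hk hi.1
      refine ⟨fun h => ?_, h2, by rw [pairing_reflection_of_orth hv, hi.2.2]⟩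
      have h3 : i = negIdx P k := by
        rw [negIdx, ← RootPairing.reflectionPerm_self (P := P) (i := k) (j := i), h]
      rw [h3, isPos_negIdx] at hi
      exact hi.2.1 (b.isPos_of_mem_support hk)
    have : ∑ i ∈ S.erase k, P.pairing i k = ∑ i ∈ S.erase k, -P.pairing i k := by
      refine Finset.sum_nbij' (P.reflectionPerm k) (P.reflectionPerm k) ?_ ?_ ?_ ?_ ?_
      · exact hmem
      · exact hmem
      · simp
      · simp
      · intro i _
        rw [← RootPairing.pairing_reflectionPerm,
          RootPairing.pairing_reflectionPerm_self_right, neg_neg]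
    rw [Finset.sum_neg_distrib] at this
    linarith
  have : P.toLinearMap (weylVectorOrth b v) (P.coroot k) = 1 / 2 * ∑ i ∈ S, P.pairing i k := by
    simp [weylVectorOrth, ← hS]
  rw [this, ← Finset.add_sum_erase S _ hkS, h0]
  simp

variable [P.IsRootSystem]

omit [P.IsCrystallographic] [P.IsReduced] in
theorem weylVectorOrth_zero : weylVectorOrth b 0 = weylVector b := by
  unfold weylVectorOrth weylVector
  congr 2
  ext i
  simp

omit [P.IsCrystallographic] [P.IsReduced] in
theorem weylVectorOrth_fundamentalWeight (p : b.support) :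
    weylVectorOrth b (fundamentalWeight b p) = weylVectorAt b p := rfl

theorem coheight_of_mem_support {k : ι} (hk : k ∈ b.support) : coheight b k = 1 := by
  rw [coheight, ← weylVectorOrth_zero]
  exact pairing_weylVectorOrth b hk (by simp)

omit [Fintype ι] [P.IsCrystallographic] [P.IsReduced] in
theorem exists_linear_pos : ∃ φ : V →ₗ[ℝ] ℝ, ∀ i, b.IsPos i → 0 < φ (P.root i) := by
  refine ⟨∑ k, b.toWeightBasis.coord k, fun i hi => ?_⟩
  obtain ⟨f, -, -, hf⟩ := b.exists_root_eq_sum_int i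
  have h1 := RootPairing.Base.height_eq_sum hf
  have h2 : ∀ k ∈ b.support, (∑ l, b.toWeightBasis.coord l) (P.root k) = 1 := by
    intro k hk
    have : b.toWeightBasis.repr (P.root k) = Finsupp.single ⟨k, hk⟩ 1 :=
      b.toWeightBasis_repr_root ⟨k, hk⟩
    classical
    simp [this, Finsupp.single_apply]
  have h3 : (∑ l, b.toWeightBasis.coord l) (P.root i) = (b.height i : ℝ) := by
    rw [hf, map_sum, h1, Int.cast_sum]
    refine Finset.sum_congr rfl fun k hk => ?_
    rw [map_zsmul, h2 k hk]
    simp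
  rw [h3]
  exact_mod_cast hi

/-- For a dominant `v`, the stabilizer of `v` in the Weyl group contains an element that takes the
simple roots orthogonal to `v` to negative roots. -/
theorem exists_smul_simple_neg (v : V) : ∃ w : P.weylGroup, w • v = v ∧
    w • (weylVector b - weylVectorOrth b v) = weylVector b - weylVectorOrth b v ∧
    ∀ k ∈ b.support, P.toLinearMap v (P.coroot k) = 0 → ¬ b.IsPos (w • k) := by
  obtain ⟨φ, hφ⟩ := exists_linear_pos b
  set u := weylVector b - weylVectorOrth b v with hu
  -- If a minimizer `w` made `w α_k` positive, then `w s_k` would still fix `v` and `u`, and since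
  -- `s_k ρ = ρ - α_k` it would lower the value by `φ(w α_k) > 0`.
  obtain ⟨w, ⟨hw1, hw2⟩, hw⟩ := Set.exists_min_image {w : P.weylGroup | w • v = v ∧ w • u = u}
    (fun w => φ (w • weylVector b)) (Set.toFinite _) ⟨1, by simp⟩
  refine ⟨w, hw1, hw2, fun k hk hv hpos => ?_⟩
  have hu0 : P.toLinearMap u (P.coroot k) = 0 := by
    rw [hu, map_sub, LinearMap.sub_apply, pairing_weylVectorOrth b hk hv]
    exact sub_eq_zero.2 (coheight_of_mem_support b hk)
  have h1 := hw (w * RootPairing.weylGroup.ofIdx P k)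
    ⟨by rw [mul_smul, ofIdx_smul_of_orth hv, hw1], by rw [mul_smul, ofIdx_smul_of_orth hu0, hw2]⟩
  have h2 : P.toLinearMap (weylVector b) (P.coroot k) = 1 := coheight_of_mem_support b hk
  rw [mul_smul, ofIdx_smul_eq, h2, one_smul, smul_sub, weylGroup_smul_root, map_sub] at h1
  linarith [hφ _ hpos]

theorem coheight_eq_height (i : ι) : coheight b i = b.flip.height i := by
  obtain ⟨f, -, -, h⟩ := b.flip.exists_root_eq_sum_int i
  have h' : P.coroot i = ∑ j ∈ b.support, f j • P.coroot j := h
  rw [RootPairing.Base.height_eq_sum h, coheight, h', map_sum]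
  push_cast
  refine Finset.sum_congr rfl fun k hk => ?_
  have h1 : P.toLinearMap (weylVector b) (P.coroot k) = 1 := coheight_of_mem_support b hk
  rw [map_zsmul, h1]
  simp

theorem isPos_iff_coheight_pos (i : ι) : b.IsPos i ↔ 0 < coheight b i := by
  rw [coheight_eq_height, ← isPos_flip_iff, RootPairing.Base.isPos_iff]
  norm_cast

/-- As `v` is dominant, a positive coroot orthogonal to `v` involves only simple coroots orthogonal
to `v`, and `w` makes each of these negative. -/
theorem isPos_smul_of_orth {v : V} (hv : ∀ k ∈ b.support, 0 ≤ P.toLinearMap v (P.coroot k))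
    {w : P.weylGroup}
    (hw : ∀ k ∈ b.support, P.toLinearMap v (P.coroot k) = 0 → ¬ b.IsPos (w • k)) {i : ι}
    (hi : b.IsPos i) (hvi : P.toLinearMap v (P.coroot i) = 0) : ¬ b.IsPos (w • i) := by
  obtain ⟨f, hf, h⟩ := exists_coroot_eq_sum b i
  replace hf : ∀ k, (0 : ℝ) ≤ f k := fun k => by
    exact_mod_cast (hf.resolve_right fun h => h.1 hi).2 k
  have hsum (u : V) : P.toLinearMap u (P.coroot i) =
      ∑ k, f k * P.toLinearMap u (P.coroot k) := by
    rw [h, map_sum]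
    simp
  rw [hsum, Finset.sum_eq_zero_iff_of_nonneg
    fun k _ => mul_nonneg (hf k) (hv k k.2)] at hvi
  rw [isPos_iff_coheight_pos, coheight, ← weylGroup_pairing w⁻¹, inv_smul_smul, hsum, not_lt]
  refine Finset.sum_nonpos fun k hk => ?_
  rcases mul_eq_zero.1 (hvi k hk) with h0 | h0
  · simp [h0]
  · have h1 := hw k k.2 h0
    rw [isPos_iff_coheight_pos, coheight, ← weylGroup_pairing w⁻¹, inv_smul_smul, not_lt] at h1
    exact mul_nonpos_of_nonneg_of_nonpos (hf k) h1

/-- Write `ρ_v` for `weylVectorOrth b v`. The element found above fixes `ρ - ρ_v` and negates `ρ_v`,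
so `w⁻¹ ρ = ρ - 2 ρ_v`, which gives the height formula. The cases used are `v = 0` and `v = λ_p`. -/
theorem exists_longest (v : V) (hv : ∀ k ∈ b.support, 0 ≤ P.toLinearMap v (P.coroot k)) :
    ∃ w : P.weylGroup, ∀ i,
      P.toLinearMap v (P.coroot (w • i)) = P.toLinearMap v (P.coroot i) ∧
      coheight b (w • i) =
        2 * P.toLinearMap (weylVector b - weylVectorOrth b v) (P.coroot i) - coheight b i := by
  obtain ⟨w, hw1, hw2, hw3⟩ := exists_smul_simple_neg b v
  have hv' : ∀ i, P.toLinearMap v (P.coroot (w • i)) = P.toLinearMap v (P.coroot i) := fun i => by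
    conv_lhs => rw [← hw1]
    exact weylGroup_pairing w v i
  have hρ : w • weylVectorOrth b v = -weylVectorOrth b v := by
    classical
    have hmaps : Set.MapsTo (fun i => negIdx P (w • i))
        ({i | b.IsPos i ∧ P.toLinearMap v (P.coroot i) = 0} : Finset ι)
        ({i | b.IsPos i ∧ P.toLinearMap v (P.coroot i) = 0} : Finset ι) := by
      intro i hi
      simp only [Finset.coe_filter, Finset.mem_univ, true_and, Set.mem_ofPred_eq] at hi ⊢
      exact ⟨(isPos_negIdx b _).2 (isPos_smul_of_orth b hv hw3 hi.1 hi.2),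
        by rw [pairing_negIdx, hv', hi.2, neg_zero]⟩
    have hinj : Function.Injective (fun i => negIdx P (w • i)) := fun i j hij => by
      have h := congrArg (negIdx P) hij
      simp only [negIdx_negIdx] at h
      exact MulAction.injective w h
    rw [weylVectorOrth, weylGroup_smul_real, Finset.smul_sum, ← smul_neg, ← Finset.sum_neg_distrib]
    congr 1
    refine Finset.sum_nbij (fun i => negIdx P (w • i)) hmaps hinj.injOn
      (Finset.surjOn_of_injOn_of_card_le _ hmaps hinj.injOn le_rfl) fun i _ => ?_
    rw [weylGroup_smul_root, root_negIdx, neg_neg]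
  refine ⟨w, fun i => ⟨hv' i, ?_⟩⟩
  have h1 : w⁻¹ • weylVector b = weylVector b - (2 : ℝ) • weylVectorOrth b v := by
    rw [inv_smul_eq_iff, show weylVector b - (2 : ℝ) • weylVectorOrth b v =
      (weylVector b - weylVectorOrth b v) - weylVectorOrth b v by module, smul_sub, hw2, hρ]
    module
  rw [coheight, ← weylGroup_pairing w⁻¹, inv_smul_smul, h1, coheight]
  simp only [map_sub, map_smul, LinearMap.sub_apply, LinearMap.smul_apply, smul_eq_mul]
  ring

end LongestElements

/-! ### Complex pairings, levels and heights in coordinates -/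

section Coordinates

variable {ι V V' : Type*} [AddCommGroup V] [Module ℝ V]
  [AddCommGroup V'] [Module ℝ V'] {P : RootPairing ι ℝ V V'}

theorem pairC_tmul (z : ℂ) (v : V) (y : V') :
    pairC P (z ⊗ₜ v) y = z * P.toLinearMap v y := by
  simp [pairC, mul_comm]

theorem pairC_add (x x' : ℂ ⊗[ℝ] V) (y : V') :
    pairC P (x + x') y = pairC P x y + pairC P x' y := by
  simp [pairC]

theorem pairC_sub (x x' : ℂ ⊗[ℝ] V) (y : V') :
    pairC P (x - x') y = pairC P x y - pairC P x' y := by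
  simp [pairC]

theorem pairC_sum {I : Type*} (s : Finset I) (x : I → ℂ ⊗[ℝ] V) (y : V') :
    pairC P (∑ k ∈ s, x k) y = ∑ k ∈ s, pairC P (x k) y := by
  simp [pairC]

theorem pairC_zero_right (x : ℂ ⊗[ℝ] V) : pairC P x 0 = 0 := by
  simp [pairC]

theorem pairC_weylC (w : P.weylGroup) (x : ℂ ⊗[ℝ] V) (i : ι) :
    pairC P (weylC w x) (P.coroot i) = pairC P x (P.coroot (w⁻¹ • i)) := by
  induction x with
  | zero => simp [pairC, weylC]
  | tmul z v =>
    have : weylC w (z ⊗ₜ v) = z ⊗ₜ[ℝ] (w • v) := by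
      simp [weylC]
      rfl
    rw [this, pairC_tmul, pairC_tmul, weylGroup_pairing_smul_left]
  | add x y hx hy =>
    have : weylC w (x + y) = weylC w x + weylC w y := by simp [weylC]
    rw [this, pairC_add, pairC_add, hx, hy]

variable [P.IsRootSystem] (b : P.Base)

/-- The value `⟨λ_p, α^∨⟩`. -/
def level (p : b.support) (i : ι) : ℝ := P.toLinearMap (fundamentalWeight b p) (P.coroot i)

theorem level_self (p : b.support) : level b p p = 1 := by
  simp [level, pairing_fundamentalWeight]

theorem level_of_ne {p k : b.support} (h : k ≠ p) : level b p k = 0 := by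
  simp [level, pairing_fundamentalWeight, h]

theorem level_negIdx (p : b.support) (i : ι) : level b p (negIdx P i) = -level b p i :=
  pairing_negIdx _ i

variable [Fintype ι]

/-- The value `⟨λ, α^∨⟩` at the point `λ` with coordinates `t`. -/
def coordPairing (t : b.support → ℂ) (i : ι) : ℂ := coheight b i + ∑ k, t k * level b k i

theorem pairC_fromCoords (t : b.support → ℂ) (i : ι) :
    pairC P (fromCoords b t) (P.coroot i) = coordPairing b t i := by
  simp [fromCoords, pairC_add, pairC_sum, pairC_tmul, coordPairing, coheight, level]

theorem coheight_negIdx (i : ι) : coheight b (negIdx P i) = -coheight b i :=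
  pairing_negIdx _ i

/-- The value `⟨λ, α^∨⟩` at `λ = ρ + s λ_p`. -/
def linePairing (p : b.support) (s : ℂ) (i : ι) : ℂ := level b p i * s + coheight b i

open scoped Classical in
theorem coordPairing_single (p : b.support) (s : ℂ) (i : ι) :
    coordPairing b (Pi.single p s) i = linePairing b p s i := by
  simp [coordPairing, linePairing, Pi.single_apply, mul_comm, add_comm]

theorem linePairing_negIdx (p : b.support) (s : ℂ) (i : ι) :
    linePairing b p s (negIdx P i) = -linePairing b p s i := by
  simp [linePairing, level_negIdx, coheight_negIdx]
  ring

variable [P.IsCrystallographic] [P.IsReduced]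

theorem exists_level_eq_coeff (i : ι) : ∃ f : b.support → ℤ,
    ((b.IsPos i ∧ ∀ k, 0 ≤ f k) ∨ (¬ b.IsPos i ∧ ∀ k, f k ≤ 0)) ∧
      P.coroot i = ∑ k, f k • P.coroot k ∧ ∀ k, level b k i = f k := by
  classical
  obtain ⟨f, hf, h⟩ := exists_coroot_eq_sum b i
  refine ⟨f, hf, h, fun k => ?_⟩
  rw [level, h, map_sum]
  simp [pairing_fundamentalWeight]

theorem exists_level_eq_int (p : b.support) (i : ι) : ∃ n : ℤ, level b p i = n := by
  obtain ⟨f, -, -, h⟩ := exists_level_eq_coeff b i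
  exact ⟨f p, h p⟩

theorem level_nonneg (p : b.support) {i : ι} (hi : b.IsPos i) : 0 ≤ level b p i := by
  obtain ⟨f, hf, -, h⟩ := exists_level_eq_coeff b i
  rw [h p]
  exact_mod_cast (hf.resolve_right fun h => h.1 hi).2 p

theorem one_le_coheight {i : ι} (hi : b.IsPos i) : 1 ≤ coheight b i := by
  rw [isPos_iff_coheight_pos, coheight_eq_height] at hi
  rw [coheight_eq_height]
  exact_mod_cast hi

theorem pairing_eq_sum_level (v : V) (i : ι) : P.toLinearMap v (P.coroot i) =
    ∑ k, level b k i * P.toLinearMap v (P.coroot k) := by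
  obtain ⟨f, -, h, hl⟩ := exists_level_eq_coeff b i
  rw [h, map_sum]
  simp [hl]

/-- The coefficients in simple coroots are nonnegative integers with sum 1, so exactly one is
nonzero. Thus simplicity, like positivity, can be read off from the height. -/
theorem mem_support_of_coheight_eq_one {i : ι} (hi : coheight b i = 1) : i ∈ b.support := by
  classical
  obtain ⟨f, hf, h, hl⟩ := exists_level_eq_coeff b i
  have hpos : b.IsPos i := by rw [isPos_iff_coheight_pos, hi]; exact one_pos
  replace hf := (hf.resolve_right fun h => h.1 hpos).2
  have h1 : ∑ k, f k = 1 := by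
    have h2 := pairing_eq_sum_level b (weylVector b) i
    have h3 : ∀ k : b.support, P.toLinearMap (weylVector b) (P.coroot k) = 1 := fun k =>
      coheight_of_mem_support b k.2
    simp only [h3, hl, mul_one] at h2
    rw [coheight] at hi
    rw [hi] at h2
    exact_mod_cast h2.symm
  obtain ⟨k, -, hk⟩ : ∃ k ∈ Finset.univ, 0 < f k := by
    by_contra! hn
    have := Finset.sum_nonpos hn
    omega
  have h4 : ∀ j, j ≠ k → f j = 0 := by
    intro j hj
    have h5 := Finset.add_sum_erase Finset.univ f (Finset.mem_univ k)
    have h6 := Finset.single_le_sum (f := f) (s := Finset.univ.erase k) (fun i _ => hf i)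
      (Finset.mem_erase.2 ⟨hj, Finset.mem_univ j⟩)
    have := hf j
    omega
  have h7 : f k = 1 := by
    rw [← h1, Finset.sum_eq_single k (fun j _ hj => h4 j hj) (by simp)]
  rw [Finset.sum_eq_single k (fun j _ hj => by simp [h4 j hj]) (by simp), h7, one_smul] at h
  rw [P.coroot.injective h]
  exact k.2

theorem mem_support_iff_coheight (i : ι) : i ∈ b.support ↔ coheight b i = 1 :=
  ⟨coheight_of_mem_support b, mem_support_of_coheight_eq_one b⟩

theorem mem_support_ne_iff (p : b.support) (i : ι) :
    (i ∈ b.support ∧ i ≠ p) ↔ coheight b i = 1 ∧ level b p i = 0 := by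
  rw [← mem_support_iff_coheight]
  refine and_congr_right fun hi => ?_
  by_cases h : i = p
  · subst h
    simp [level_self]
  · simp only [ne_eq, h, not_false_eq_true, true_iff]
    exact level_of_ne b (k := ⟨i, hi⟩) fun hh => h (congrArg Subtype.val hh)

theorem two_le_coheight {p : b.support} {i : ι} (hi : b.IsPos i) (h0 : level b p i = 0)
    (h : ¬ (i ∈ b.support ∧ i ≠ p)) : 2 ≤ coheight b i := by
  rw [mem_support_ne_iff, not_and'] at h
  have h1 := one_le_coheight b hi
  have h2 := h h0
  rw [coheight_eq_height] at *
  have h3 : b.flip.height i ≠ 1 := by exact_mod_cast h2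
  have h4 : 1 ≤ b.flip.height i := by exact_mod_cast h1
  have : 2 ≤ b.flip.height i := by omega
  exact_mod_cast this

theorem exists_longest_weylGroup : ∃ w : P.weylGroup, ∀ i, coheight b (w • i) = -coheight b i := by
  obtain ⟨w, hw⟩ := exists_longest b 0 (by simp)
  refine ⟨w, fun i => ?_⟩
  rw [(hw i).2, weylVectorOrth_zero]
  simp

/-- Both `ρ` and `ρ_p` pair to 1 with the simple coroots other than that of `p`, so `2 (ρ - ρ_p) =
c_p λ_p`. -/
theorem exists_longest_parabolic (p : b.support) : ∃ w : P.weylGroup, ∀ i,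
    level b p (w • i) = level b p i ∧
      coheight b (w • i) = centerConst b p * level b p i - coheight b i := by
  obtain ⟨w, hw⟩ := exists_longest b (fundamentalWeight b p) fun k hk =>
    level_nonneg b p (b.isPos_of_mem_support hk)
  refine ⟨w, fun i => ⟨(hw i).1, ?_⟩⟩
  rw [(hw i).2, weylVectorOrth_fundamentalWeight, pairing_eq_sum_level b,
    Finset.sum_eq_single p]
  · have h1 : P.toLinearMap (weylVector b) (P.coroot p) = 1 := coheight_of_mem_support b p.2
    have h2 : P.toLinearMap (fundamentalWeight b p) (P.coroot p) = 1 := level_self b p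
    simp only [centerConst, map_sub, LinearMap.sub_apply, h1, h2]
    ring
  · intro k _ hk
    have h1 : P.toLinearMap (weylVector b) (P.coroot k) = 1 := coheight_of_mem_support b k.2
    have h2 : P.toLinearMap (weylVectorAt b p) (P.coroot k) = 1 :=
      pairing_weylVectorOrth b k.2 (level_of_ne b hk)
    simp [h1, h2]
  · simp

/-- Evaluating the height formula at `p` gives `c_p = ht(w α_p^∨) + 1`, and heights are integers. -/
theorem exists_centerConst_eq_int (p : b.support) : ∃ c : ℤ, centerConst b p = c := by
  obtain ⟨w, hw⟩ := exists_longest_parabolic b p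
  have h := (hw p).2
  rw [level_self, coheight_eq_height, coheight_of_mem_support b p.2, mul_one] at h
  exact ⟨b.flip.height (w • (p : ι)) + 1, by push_cast; linarith⟩

end Coordinates

/-! ### Iterated residues of functions with simple polar factors -/

section Residues

open Filter Complex

/-- The residue of a function with at most a simple pole. -/
theorem residue_eq {f g h : ℂ → ℂ} {a : ℂ} {ε : ℝ} (hε : 0 < ε)
    (hg : DifferentiableOn ℂ g (Metric.ball a ε)) (hh : DifferentiableOn ℂ h (Metric.ball a ε))
    (hf : ∀ z ∈ Metric.ball a ε, z ≠ a → f z = g z + (z - a)⁻¹ * h z) : residue f a = h a := by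
  refine Tendsto.limUnder_eq (tendsto_const_nhds.congr' ?_)
  filter_upwards [Ioo_mem_nhdsGT hε] with R hR
  have hsub : Metric.closedBall a R ⊆ Metric.ball a ε := Metric.closedBall_subset_ball hR.2
  have h1 : (∮ z in C(a, R), f z) = ∮ z in C(a, R), (g z + (z - a)⁻¹ • h z) := by
    refine circleIntegral.integral_congr hR.1.le fun z hz => ?_
    rw [smul_eq_mul]
    refine hf z (hsub (Metric.sphere_subset_closedBall hz)) ?_
    rintro rfl
    simp only [Metric.mem_sphere, dist_self] at hz
    exact hR.1.ne hz
  have hgc : CircleIntegrable g a R :=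
    (hg.continuousOn.mono (Metric.sphere_subset_closedBall.trans hsub)).circleIntegrable hR.1.le
  have hhc : CircleIntegrable (fun z => (z - a)⁻¹ • h z) a R := by
    refine ContinuousOn.circleIntegrable hR.1.le (ContinuousOn.fun_smul ?_
      (hh.continuousOn.mono (Metric.sphere_subset_closedBall.trans hsub)))
    refine ContinuousOn.inv₀ (by fun_prop) fun z hz hz0 => ?_
    rw [sub_eq_zero.1 hz0, Metric.mem_sphere, dist_self] at hz
    exact hR.1.ne hz
  have h2 : (∮ z in C(a, R), g z) = 0 :=
    (hg.mono (Metric.closure_ball_subset_closedBall.trans hsub)).diffContOnCl.circleIntegral_eq_zero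
      hR.1.le
  have h3 : (∮ z in C(a, R), (z - a)⁻¹ • h z) = (2 * Real.pi * I : ℂ) • h a :=
    (hh.mono hsub).circleIntegral_sub_inv_smul (Metric.mem_ball_self hR.1)
  rw [h1, circleIntegral.integral_add hgc hhc, h2, h3, zero_add, smul_eq_mul,
    inv_mul_cancel_left₀ two_pi_I_ne_zero]

/-- The definition peels off the outermost residue. Induction on explicit formulas needs the
innermost one, at the end of the list. -/
theorem iteratedResidue_append {I : Type*} [DecidableEq I] (L : List I) (k : I)
    (F : (I → ℂ) → ℂ) : iteratedResidue (L ++ [k]) F =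
      iteratedResidue L fun t => residue (fun z => F (Function.update t k z)) 0 := by
  induction L with
  | nil =>
    funext t
    simp only [List.nil_append, iteratedResidue]
    congr! 4
  | cons j L ih =>
    funext t
    simp only [List.cons_append, iteratedResidue, ih]

theorem update_mem_ball {I : Type*} [Fintype I] [DecidableEq I] {t₀ t : I → ℂ} {ε : ℝ} {k : I}
    (hk : t₀ k = 0) (ht : t ∈ Metric.ball t₀ ε) {z : ℂ} (hz : z ∈ Metric.ball 0 ε) :
    Function.update t k z ∈ Metric.ball t₀ ε := by
  have hε : 0 < ε := Metric.pos_of_mem_ball ht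
  rw [Metric.mem_ball, dist_pi_lt_iff hε] at ht ⊢
  intro j
  by_cases hj : j = k
  · subst hj
    simpa [hk] using hz
  · simpa [hj] using ht j

/-- Iterated residues of a sum of products of simple polar factors and holomorphic functions. -/
theorem iteratedResidue_eq_sum {I W : Type*} [Fintype I] [DecidableEq I] (l : List I)
    (hl : l.Nodup) {t₀ : I → ℂ} {ε : ℝ} (hε : 0 < ε) (ht₀ : ∀ k ∈ l, t₀ k = 0) (A : Finset W)
    (S : W → Finset I) (hS : ∀ w ∈ A, S w ⊆ l.toFinset) (G : W → (I → ℂ) → ℂ)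
    (hG : ∀ w ∈ A, DifferentiableOn ℂ (G w) (Metric.ball t₀ ε)) (F : (I → ℂ) → ℂ)
    (hF : ∀ t ∈ Metric.ball t₀ ε, (∀ k ∈ l, t k ≠ 0) →
      F t = ∑ w ∈ A, G w t * ∏ k ∈ S w, (t k)⁻¹)
    (B : Finset W) (hB : ∀ w, w ∈ B ↔ w ∈ A ∧ ∀ k ∈ l, k ∈ S w) :
    iteratedResidue l F t₀ = ∑ w ∈ B, G w t₀ := by
  induction l using List.reverseRecOn generalizing A S G F with
  | nil =>
    rw [iteratedResidue, hF t₀ (Metric.mem_ball_self hε) (by simp)]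
    have hBA : B = A := by ext w; simp [hB]
    rw [hBA]
    refine Finset.sum_congr rfl fun w hw => ?_
    have : S w = ∅ := by simpa using hS w hw
    simp [this]
  | append_singleton L k ih =>
    have hkL : k ∉ L := by
      have := hl
      simp only [List.nodup_append, List.mem_singleton, forall_eq] at this
      exact fun h => this.2.2 k h rfl
    have hk0 : t₀ k = 0 := ht₀ k (by simp)
    have hup0 : Function.update t₀ k 0 = t₀ := by rw [← hk0, Function.update_eq_self]
    -- The residue at `t_k = 0` drops the terms regular in `t_k` and evaluates the others at `t_k =
    -- 0`. The result has the same shape, with `k` erased from the polar sets.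
    rw [iteratedResidue_append, ih (hl.sublist (List.sublist_append_left L [k]))
      (fun j hj => ht₀ j (by simp [hj])) (A.filter fun w => k ∈ S w) (fun w => (S w).erase k)
      ?_ (fun w t => G w (Function.update t k 0)) ?_ _ ?_ fun w => ?_]
    · exact Finset.sum_congr rfl fun w _ => by rw [hup0]
    · intro w hw j hj
      have h1 := hS w (Finset.mem_filter.1 hw).1 (Finset.mem_erase.1 hj).2
      simp only [List.toFinset_append, List.toFinset_cons, List.toFinset_nil, Finset.mem_union,
        List.mem_toFinset, Finset.mem_insert, Finset.notMem_empty, or_false] at h1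
      exact List.mem_toFinset.2 (h1.resolve_right (Finset.mem_erase.1 hj).1)
    · intro w hw
      refine (hG w (Finset.mem_filter.1 hw).1).comp ?_ fun t ht =>
        update_mem_ball hk0 ht (Metric.mem_ball_self hε)
      refine Differentiable.differentiableOn (differentiable_pi.2 fun j => ?_)
      by_cases hj : j = k
      · subst hj
        simp
      · simp only [Function.update_of_ne hj]
        fun_prop
    · intro t ht htL
      have hupd : ∀ w ∈ A, DifferentiableOn ℂ (fun z => G w (Function.update t k z))
          (Metric.ball 0 ε) := fun w hw => by
        refine (hG w hw).comp ?_ fun z hz => update_mem_ball hk0 ht hz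
        refine Differentiable.differentiableOn (differentiable_pi.2 fun j => ?_)
        by_cases hj : j = k
        · subst hj
          simp
        · simp only [Function.update_of_ne hj]
          fun_prop
      refine residue_eq (a := 0) hε
        (g := fun z => ∑ w ∈ A with k ∉ S w,
          G w (Function.update t k z) * ∏ j ∈ (S w).erase k, (t j)⁻¹)
        (h := fun z => ∑ w ∈ A with k ∈ S w,
          G w (Function.update t k z) * ∏ j ∈ (S w).erase k, (t j)⁻¹) ?_ ?_ ?_
      · exact DifferentiableOn.fun_sum fun w hw =>
          (hupd w (Finset.mem_filter.1 hw).1).mul_const _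
      · exact DifferentiableOn.fun_sum fun w hw =>
          (hupd w (Finset.mem_filter.1 hw).1).mul_const _
      · intro z hz hz0
        rw [hF _ (update_mem_ball hk0 ht hz)]
        · rw [← Finset.sum_filter_add_sum_filter_not A (fun w => k ∈ S w), add_comm,
            Finset.mul_sum, sub_zero]
          have hprod (w : W) : ∏ j ∈ (S w).erase k, (Function.update t k z j)⁻¹ =
              ∏ j ∈ (S w).erase k, (t j)⁻¹ := Finset.prod_congr rfl fun j hj => by
            rw [Function.update_of_ne (Finset.mem_erase.1 hj).1]
          congr 1
          · refine Finset.sum_congr rfl fun w hw => ?_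
            rw [← hprod, Finset.erase_eq_of_notMem (Finset.mem_filter.1 hw).2]
          · refine Finset.sum_congr rfl fun w hw => ?_
            rw [← Finset.mul_prod_erase _ _ (Finset.mem_filter.1 hw).2, hprod,
              Function.update_self]
            ring
        · intro j hj
          by_cases hjk : j = k
          · subst hjk
            simpa using hz0
          · rw [Function.update_of_ne hjk]
            refine htL j ?_
            simpa [hjk] using hj
    · rw [hB, Finset.mem_filter, and_assoc]
      refine and_congr_right fun _ => ?_
      simp only [List.mem_append, List.mem_singleton, Finset.mem_erase]
      constructor
      · exact fun h => ⟨h k (Or.inr rfl), fun j hj => ⟨fun e => hkL (e ▸ hj), h j (Or.inl hj)⟩⟩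
      · rintro ⟨h1, h2⟩ j (hj | rfl)
        exacts [(h2 j hj).2, h1]

end Residues

/-! ### Poles and zeros of the completed zeta function -/

section CompletedZeta

open Filter

/-- The regularization `z ξ(1 + z)` of the pole of `ξ` at `1`. -/
def xiReg (z : ℂ) : ℂ := z * (completedRiemannZeta₀ (1 + z) - 1 / (1 + z)) + 1

/-- The residue of `ξ` at 1 is 1, so the poles of `ξ` contribute no constants to the iterated
residue. -/
theorem xiReg_zero : xiReg 0 = 1 := by simp [xiReg]

theorem completedRiemannZeta_one_add {z : ℂ} (hz : z ≠ 0) :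
    completedRiemannZeta (1 + z) = xiReg z * z⁻¹ := by
  rw [completedRiemannZeta_eq, xiReg]
  have : 1 - (1 + z) = -z := by ring
  rw [this]
  field_simp
  ring

theorem analyticAt_xiReg {z : ℂ} (hz : 1 + z ≠ 0) : AnalyticAt ℂ xiReg z := by
  have h0 : AnalyticAt ℂ (fun z => completedRiemannZeta₀ (1 + z)) z :=
    (differentiable_completedZeta₀.comp (by fun_prop : Differentiable ℂ fun z : ℂ => 1 + z)).analyticAt z
  unfold xiReg
  fun_prop (disch := assumption)

theorem analyticAt_completedRiemannZeta {z : ℂ} (h0 : z ≠ 0) (h1 : z ≠ 1) :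
    AnalyticAt ℂ completedRiemannZeta z := by
  refine DifferentiableOn.analyticAt (s := {0, 1}ᶜ) (fun w hw => ?_) ?_
  · simp only [Set.mem_compl_iff, Set.mem_insert_iff, Set.mem_singleton_iff, not_or] at hw
    exact (differentiableAt_completedZeta hw.1 hw.2).differentiableWithinAt
  · exact (Set.toFinite _).isClosed.isOpen_compl.mem_nhds (by simp [h0, h1])

/-- The points at which `ξ` is holomorphic and does not vanish. -/
def XiUnit (z : ℂ) : Prop := z ≠ 0 ∧ z ≠ 1 ∧ completedRiemannZeta z ≠ 0

theorem xiUnit_of_two_le {x : ℝ} (hx : 2 ≤ x) : XiUnit x := by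
  have h0 : (x : ℂ) ≠ 0 := by exact_mod_cast (by linarith : x ≠ 0)
  have h1 : (x : ℂ) ≠ 1 := by exact_mod_cast (by linarith : x ≠ 1)
  refine ⟨h0, h1, fun h => ?_⟩
  refine riemannZeta_ne_zero_of_one_le_re (s := x) (by simp; linarith) ?_
  rw [riemannZeta_def_of_ne_zero h0, h, zero_div]

theorem meromorphic_completedRiemannZeta : Meromorphic completedRiemannZeta := by
  have h : completedRiemannZeta = fun s => completedRiemannZeta₀ s - 1 / s - 1 / (1 - s) :=
    funext completedRiemannZeta_eq
  rw [h]
  have h0 : Meromorphic completedRiemannZeta₀ := fun z =>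
    (differentiable_completedZeta₀.analyticAt z).meromorphicAt
  intro z
  have := h0 z
  fun_prop

theorem eventually_xiUnit (z : ℂ) : ∀ᶠ w in 𝓝[≠] z, XiUnit w := by
  -- This entire function equals `s (1 - s) ξ(s)` away from 0 and 1. Its value at 0 is -1, so its
  -- zeros are isolated.
  let Ξ : ℂ → ℂ := fun s => s * (1 - s) * completedRiemannZeta₀ s - 1
  have hΞ : Differentiable ℂ Ξ := by
    have := differentiable_completedZeta₀
    fun_prop
  have h1 : ∀ᶠ w in 𝓝[≠] z, Ξ w ≠ 0 := by
    by_contra hn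
    have h2 : ∃ᶠ w in 𝓝[≠] z, Ξ w = 0 := hn
    have h3 := AnalyticOnNhd.eqOn_zero_of_preconnected_of_frequently_eq_zero (f := Ξ)
      (U := Set.univ) (fun w _ => hΞ.analyticAt w) isPreconnected_univ (Set.mem_univ z) h2
    have := h3 (Set.mem_univ 0)
    simp only [Ξ, zero_mul, zero_sub, Pi.zero_apply, neg_eq_zero] at this
    exact one_ne_zero this
  have h4 : ∀ c : ℂ, ∀ᶠ w in 𝓝[≠] z, w ≠ c := fun c => by
    by_cases hc : z = c
    · subst hc
      exact eventually_mem_nhdsWithin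
    · exact eventually_nhdsWithin_of_eventually_nhds (eventually_ne_nhds hc)
  filter_upwards [h1, h4 0, h4 1] with w h1 h2 h3
  refine ⟨h2, h3, fun h => h1 ?_⟩
  have h5 : 1 - w ≠ 0 := sub_ne_zero.2 (Ne.symm h3)
  rw [completedRiemannZeta_eq] at h
  have : Ξ w = w * (1 - w) * (completedRiemannZeta₀ w - 1 / w - 1 / (1 - w)) := by
    simp only [Ξ]
    field_simp
    ring
  rw [this, h, mul_zero]

theorem eventually_xiUnit_affine {k : ℂ} (hk : k ≠ 0) (h z : ℂ) :
    ∀ᶠ s in 𝓝[≠] z, XiUnit (k * s + h) := by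
  refine Tendsto.eventually ?_ (eventually_xiUnit (k * z + h))
  refine tendsto_nhdsWithin_of_tendsto_nhds_of_eventually_within _ ?_ ?_
  · exact (Continuous.tendsto (by fun_prop) z).mono_left nhdsWithin_le_nhds
  · filter_upwards [eventually_mem_nhdsWithin] with s hs
    simpa [hk] using hs

end CompletedZeta

/-! ### Explicit formula for the residual period at `T = 0` -/

section ResidueSum

open Filter

variable {ι V V' : Type*} [AddCommGroup V] [Module ℝ V]
  [AddCommGroup V'] [Module ℝ V'] {P : RootPairing ι ℝ V V'} (b : P.Base)

/-- The simple roots different from `α_p`. -/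
def LeviSimple (p : b.support) (i : ι) : Prop := i ∈ b.support ∧ i ≠ p

variable [Fintype ι] [P.IsRootSystem]

open scoped Classical in
/-- The term of `ω^{G/P}(s; 0)` that belongs to an element of the Weyl group. -/
def residueTerm (p : b.support) (w : P.weylGroup) (s : ℂ) : ℂ :=
  (∏ i ∈ b.support with ¬ LeviSimple b p (w⁻¹ • i), (linePairing b p s (w⁻¹ • i) - 1)⁻¹) *
    (∏ i ∈ inversions b w with ¬ LeviSimple b p i, completedRiemannZeta (linePairing b p s i)) *
    ∏ i ∈ inversions b w, (completedRiemannZeta (linePairing b p s i + 1))⁻¹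

open scoped Classical in
/-- The explicit expression for `ω^{G/P}(s; 0)`. -/
def residueSum (p : b.support) (s : ℂ) : ℂ :=
  ∑ w : P.weylGroup with Admissible b p w, residueTerm b p w s

/-- The points `s` at which all nonconstant arguments of `ξ` are regular. -/
def Generic (p : b.support) (s : ℂ) : Prop :=
  ∀ i, level b p i ≠ 0 → XiUnit (linePairing b p s i) ∧ XiUnit (linePairing b p s i + 1)

theorem eventually_generic (p : b.support) (z : ℂ) : ∀ᶠ s in 𝓝[≠] z, Generic b p s := by
  refine eventually_all.2 fun i => ?_
  by_cases h : level b p i = 0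
  · simp [h]
  · have h' : (level b p i : ℂ) ≠ 0 := by exact_mod_cast h
    filter_upwards [eventually_xiUnit_affine h' (coheight b i) z,
      eventually_xiUnit_affine h' (coheight b i + 1) z] with s h1 h2 _
    exact ⟨h1, by rw [linePairing, add_assoc]; exact h2⟩

open scoped Classical in
/-- The regular part of a term of the period, in coordinates. -/
def regularTerm (p : b.support) (w : P.weylGroup) (t : b.support → ℂ) : ℂ :=
  (∏ i ∈ b.support with ¬ LeviSimple b p (w⁻¹ • i), (coordPairing b t (w⁻¹ • i) - 1)⁻¹) *
    (∏ i ∈ inversions b w with ¬ LeviSimple b p i, completedRiemannZeta (coordPairing b t i)) *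
    (∏ i ∈ inversions b w with LeviSimple b p i, xiReg (coordPairing b t i - 1)) *
    ∏ i ∈ inversions b w, (completedRiemannZeta (coordPairing b t i + 1))⁻¹

open scoped Classical in
/-- The variables in which the term of the period that belongs to `w` has a pole. -/
def polarSet (p : b.support) (w : P.weylGroup) : Finset b.support :=
  {k | k ≠ p ∧ (w • (k : ι) ∈ b.support ∨ ¬ b.IsPos (w • (k : ι)))}

theorem mem_polarSet {p k : b.support} {w : P.weylGroup} : k ∈ polarSet b p w ↔
    k ≠ p ∧ (w • (k : ι) ∈ b.support ∨ ¬ b.IsPos (w • (k : ι))) := by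
  simp [polarSet]

theorem analyticAt_coordPairing (t : b.support → ℂ) (i : ι) :
    AnalyticAt ℂ (fun t => coordPairing b t i) t := by
  have : AnalyticAt ℂ (fun t : b.support → ℂ => ∑ k, t k * level b k i) t :=
    Finset.analyticAt_fun_sum _ fun k _ =>
      ((ContinuousLinearMap.proj (R := ℂ) (φ := fun _ : b.support => ℂ) k).analyticAt t).mul
        analyticAt_const
  unfold coordPairing
  exact analyticAt_const.add this

variable [P.IsCrystallographic] [P.IsReduced]

theorem leviSimple_iff (p : b.support) (i : ι) :
    LeviSimple b p i ↔ coheight b i = 1 ∧ level b p i = 0 :=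
  mem_support_ne_iff b p i

theorem coordPairing_of_mem_support (t : b.support → ℂ) (k : b.support) :
    coordPairing b t k = 1 + t k := by
  classical
  rw [coordPairing, coheight_of_mem_support b k.2, Finset.sum_eq_single k]
  · simp [level_self]
  · intro j _ hj
    simp [level_of_ne b hj.symm]
  · simp

open scoped Classical in
theorem linePairing_of_leviSimple (p : b.support) (s : ℂ) {i : ι} (hi : LeviSimple b p i) :
    linePairing b p s i = 1 := by
  rw [leviSimple_iff] at hi
  simp [linePairing, hi]

theorem linePairing_sub_one_ne_zero {p : b.support} {s : ℂ} (hs : Generic b p s) {i : ι}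
    (hi : ¬ LeviSimple b p i) : linePairing b p s i - 1 ≠ 0 := by
  by_cases h : level b p i = 0
  · rw [leviSimple_iff] at hi
    simp only [linePairing, h, Complex.ofReal_zero, zero_mul, zero_add]
    intro h1
    refine hi ⟨?_, h⟩
    exact_mod_cast sub_eq_zero.1 h1
  · exact sub_ne_zero.2 (hs i h).1.2.1

/-- `Generic` controls nonzero levels only. At level zero the argument is the height, which is at
least 2 once the simple roots of the Levi factor are excluded. -/
theorem xiUnit_linePairing {p : b.support} {s : ℂ} (hs : Generic b p s) {i : ι}
    (hi : ¬ LeviSimple b p i) (hpos : b.IsPos i) : XiUnit (linePairing b p s i) := by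
  by_cases h : level b p i = 0
  · simp only [linePairing, h, Complex.ofReal_zero, zero_mul, zero_add]
    exact xiUnit_of_two_le (two_le_coheight b hpos h hi)
  · exact (hs i h).1

theorem xiUnit_linePairing_add_one {p : b.support} {s : ℂ} (hs : Generic b p s) {i : ι}
    (hpos : b.IsPos i) : XiUnit (linePairing b p s i + 1) := by
  by_cases h : level b p i = 0
  · simp only [linePairing, h, Complex.ofReal_zero, zero_mul, zero_add]
    have := xiUnit_of_two_le (x := coheight b i + 1) (by linarith [one_le_coheight b hpos])
    exact_mod_cast this
  · exact (hs i h).2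

theorem analyticAt_regularTerm {p : b.support} {s : ℂ} (hs : Generic b p s) (w : P.weylGroup)
    [DecidableEq b.support] : AnalyticAt ℂ (regularTerm b p w) (Pi.single p s) := by
  have hc : ∀ i, coordPairing b (Pi.single p s) i = linePairing b p s i := by
    convert coordPairing_single b p s
  classical
  have key {f : ℂ → ℂ} {i : ι} (hf : AnalyticAt ℂ f (linePairing b p s i)) :
      AnalyticAt ℂ (fun t => f (coordPairing b t i)) (Pi.single p s) := by
    refine AnalyticAt.comp (g := f) ?_ (analyticAt_coordPairing b _ i)
    convert hf
    exact hc i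
  have hpos {i : ι} (hi : i ∈ inversions b w) : b.IsPos i := by
    simp only [inversions, Finset.mem_filter] at hi
    exact hi.2.1
  unfold regularTerm
  refine ((AnalyticAt.mul ?_ ?_).mul ?_).mul ?_
  · refine Finset.analyticAt_fun_prod _ fun i hi => ?_
    have := linePairing_sub_one_ne_zero b hs (Finset.mem_filter.1 hi).2
    exact key (f := fun z => (z - 1)⁻¹) (by fun_prop (disch := exact this))
  · refine Finset.analyticAt_fun_prod _ fun i hi => ?_
    have := xiUnit_linePairing b hs (Finset.mem_filter.1 hi).2 (hpos (Finset.mem_filter.1 hi).1)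
    exact key (analyticAt_completedRiemannZeta this.1 this.2.1)
  · refine Finset.analyticAt_fun_prod _ fun i hi => ?_
    refine key (f := fun z => xiReg (z - 1)) ?_
    refine AnalyticAt.comp (g := xiReg) (analyticAt_xiReg ?_) (by fun_prop)
    rw [linePairing_of_leviSimple b p s (Finset.mem_filter.1 hi).2]
    simp
  · refine Finset.analyticAt_fun_prod _ fun i hi => ?_
    have := xiUnit_linePairing_add_one b hs (hpos hi)
    refine key (f := fun z => (completedRiemannZeta (z + 1))⁻¹) (AnalyticAt.inv ?_ this.2.2)
    exact AnalyticAt.comp (g := completedRiemannZeta)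
      (analyticAt_completedRiemannZeta this.1 this.2.1) (by fun_prop)

theorem regularTerm_single (p : b.support) (s : ℂ) (w : P.weylGroup) [DecidableEq b.support] :
    regularTerm b p w (Pi.single p s) = residueTerm b p w s := by
  have hc : ∀ i, coordPairing b (Pi.single p s) i = linePairing b p s i := by
    convert coordPairing_single b p s
  classical
  simp only [regularTerm, residueTerm, hc]
  rw [Finset.prod_eq_one (f := fun i => xiReg (linePairing b p s i - 1)), mul_one]
  intro i hi
  rw [linePairing_of_leviSimple b p s (Finset.mem_filter.1 hi).2, sub_self, xiReg_zero]

theorem period_fromCoords (t : b.support → ℂ) : period b (fromCoords b t) 0 =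
    ∑ w : P.weylGroup, (∏ i ∈ b.support, (coordPairing b t (w⁻¹ • i) - 1)⁻¹) *
      ∏ i ∈ inversions b w, completedRiemannZeta (coordPairing b t i) *
        (completedRiemannZeta (coordPairing b t i + 1))⁻¹ := by
  unfold period
  refine Finset.sum_congr rfl fun w _ => ?_
  rw [pairC_zero_right, Complex.exp_zero, one_mul]
  congr 1
  · refine Finset.prod_congr rfl fun i hi => ?_
    rw [pairC_sub, pairC_weylC, pairC_fromCoords, pairC_tmul]
    have : P.toLinearMap (weylVector b) (P.coroot i) = 1 := coheight_of_mem_support b hi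
    rw [this]
    simp
  · refine Finset.prod_congr rfl fun i _ => ?_
    rw [pairC_fromCoords, div_eq_mul_inv]

/-- A factor `1 / t_k` has two possible sources: the rational factor at `w α_k` if this root is
simple, or the pole of `ξ(1 + t_k)` if `w α_k` is negative. They exclude each other, so all poles
are simple. -/
theorem prod_polarSet (p : b.support) (w : P.weylGroup) (t : b.support → ℂ) [DecidableEq ι]
    [DecidablePred (LeviSimple b p)] :
    ∏ k ∈ polarSet b p w, (t k)⁻¹ =
      (∏ i ∈ b.support with LeviSimple b p (w⁻¹ • i), (coordPairing b t (w⁻¹ • i) - 1)⁻¹) *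
      ∏ i ∈ inversions b w with LeviSimple b p i, (coordPairing b t i - 1)⁻¹ := by
  classical
  have hval (k : b.support) : coordPairing b t k - 1 = t k := by
    rw [coordPairing_of_mem_support]; ring
  have h1 : ∏ k : b.support with k ≠ p ∧ w • (k : ι) ∈ b.support, (t k)⁻¹ =
      ∏ i ∈ b.support with LeviSimple b p (w⁻¹ • i), (coordPairing b t (w⁻¹ • i) - 1)⁻¹ := by
    refine Finset.prod_bij (fun k _ => w • (k : ι)) ?_ ?_ ?_ ?_
    · intro k hk
      simp only [Finset.mem_filter, Finset.mem_univ, true_and] at hk ⊢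
      refine ⟨hk.2, ?_⟩
      rw [inv_smul_smul]
      exact ⟨k.2, fun h => hk.1 (Subtype.ext h)⟩
    · exact fun k _ k' _ h => Subtype.ext (MulAction.injective w h)
    · intro i hi
      simp only [Finset.mem_filter] at hi
      refine ⟨⟨w⁻¹ • i, hi.2.1⟩, ?_, by simp⟩
      simp only [Finset.mem_filter, Finset.mem_univ, true_and, smul_inv_smul]
      exact ⟨fun h => hi.2.2 (congrArg Subtype.val h), hi.1⟩
    · intro k _
      rw [inv_smul_smul, hval]
  have h2 : ∏ k : b.support with k ≠ p ∧ ¬ b.IsPos (w • (k : ι)), (t k)⁻¹ =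
      ∏ i ∈ inversions b w with LeviSimple b p i, (coordPairing b t i - 1)⁻¹ := by
    refine Finset.prod_bij (fun k _ => (k : ι)) ?_ ?_ ?_ ?_
    · intro k hk
      simp only [Finset.mem_filter, Finset.mem_univ, true_and, inversions] at hk ⊢
      exact ⟨⟨b.isPos_of_mem_support k.2, hk.2⟩, k.2, fun h => hk.1 (Subtype.ext h)⟩
    · exact fun k _ k' _ h => Subtype.ext h
    · intro i hi
      simp only [Finset.mem_filter, Finset.mem_univ, true_and, inversions] at hi
      refine ⟨⟨i, hi.2.1⟩, ?_, rfl⟩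
      simp only [Finset.mem_filter, Finset.mem_univ, true_and]
      exact ⟨fun h => hi.2.2 (congrArg Subtype.val h), hi.1.2⟩
    · intro k _
      rw [hval]
  rw [← h1, ← h2, ← Finset.prod_union]
  · refine Finset.prod_congr ?_ fun _ _ => rfl
    ext k
    simp [polarSet]
    tauto
  · rw [Finset.disjoint_filter]
    exact fun k _ hk hk' => hk'.2 (b.isPos_of_mem_support hk.2)

theorem period_fromCoords_eq (p : b.support) {t : b.support → ℂ} (ht : ∀ k, k ≠ p → t k ≠ 0) :
    period b (fromCoords b t) 0 =
      ∑ w : P.weylGroup, regularTerm b p w t * ∏ k ∈ polarSet b p w, (t k)⁻¹ := by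
  classical
  rw [period_fromCoords]
  refine Finset.sum_congr rfl fun w _ => ?_
  have hxi : ∏ i ∈ inversions b w with LeviSimple b p i,
      completedRiemannZeta (coordPairing b t i) =
      ∏ i ∈ inversions b w with LeviSimple b p i,
        (xiReg (coordPairing b t i - 1) * (coordPairing b t i - 1)⁻¹) := by
    refine Finset.prod_congr rfl fun i hi => ?_
    obtain ⟨hi1, hi2⟩ := (Finset.mem_filter.1 hi).2
    have h1 : coordPairing b t i - 1 = t ⟨i, hi1⟩ := by
      rw [coordPairing_of_mem_support b t ⟨i, hi1⟩]; ring
    have h2 := completedRiemannZeta_one_add (z := coordPairing b t i - 1)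
      (by rw [h1]; exact ht _ fun h => hi2 (congrArg Subtype.val h))
    rw [← h2]
    congr 1
    ring
  rw [Finset.prod_mul_distrib, prod_polarSet,
    ← Finset.prod_filter_mul_prod_filter_not b.support (fun i => LeviSimple b p (w⁻¹ • i)),
    ← Finset.prod_filter_mul_prod_filter_not (inversions b w) (fun i => LeviSimple b p i)
      (fun i => completedRiemannZeta (coordPairing b t i)), hxi, Finset.prod_mul_distrib,
    regularTerm]
  ring

/-- Admissibility says precisely that the polar set is all of `Δ_p`. The right-hand side no longer
involves `l`. -/
theorem residualPeriod_eq {p : b.support} {l : List b.support} (hl : IsOrdering b p l) {s : ℂ}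
    (hs : Generic b p s) : residualPeriod b p l 0 s = residueSum b p s := by
  let : DecidableEq b.support := Classical.decEq _
  classical
  set t₀ : b.support → ℂ := Pi.single p s with ht₀
  have h1 : ∀ᶠ t in 𝓝 t₀, ∀ w : P.weylGroup, AnalyticAt ℂ (regularTerm b p w) t :=
    eventually_all.2 fun w => (analyticAt_regularTerm b hs w).eventually_analyticAt
  obtain ⟨ε, hε, h2⟩ := Metric.eventually_nhds_iff_ball.1 h1
  have h3 : residualPeriod b p l 0 s =
      iteratedResidue l (fun t => period b (fromCoords b t) 0) t₀ := by
    rw [residualPeriod, ht₀]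
    congr!
  rw [h3, iteratedResidue_eq_sum l hl.1 hε (fun k hk => by simp [ht₀, (hl.2 k).1 hk]) Finset.univ
    (polarSet b p) (fun w _ k hk => ?_) (regularTerm b p)
    (fun w _ t ht => (h2 t ht w).differentiableAt.differentiableWithinAt) _
    (fun t _ ht => period_fromCoords_eq b p fun k hk => ht k ((hl.2 k).2 hk))
    (Finset.univ.filter fun w => Admissible b p w) (fun w => ?_)]
  · exact Finset.sum_congr (by congr!) fun w _ => regularTerm_single b p s w
  · exact List.mem_toFinset.2 ((hl.2 k).2 ((mem_polarSet b).1 hk).1)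
  · refine Finset.mem_filter.trans (and_congr_right fun _ => ?_)
    simp only [mem_polarSet, hl.2, Admissible]
    exact forall_congr' fun k => ⟨fun h hk => ⟨hk, h hk⟩, fun h hk => (h hk).2⟩

end ResidueSum

/-! ### The functional equation of the residual period -/

section FunctionalEquation

variable {ι V V' : Type*} [Fintype ι] [AddCommGroup V] [Module ℝ V]
  [AddCommGroup V'] [Module ℝ V'] {P : RootPairing ι ℝ V V'} [P.IsRootSystem]
  (b : P.Base)

open scoped Classical in
/-- The factor relating `ω^{G/P}(-c_p - s; 0)` and `ω^{G/P}(s; 0)`. -/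
def unipotentFactor (p : b.support) (s : ℂ) : ℂ :=
  ∏ i : ι with b.IsPos i ∧ level b p i ≠ 0,
    completedRiemannZeta (linePairing b p s i + 1) / completedRiemannZeta (linePairing b p s i)

variable [P.IsCrystallographic] [P.IsReduced]

/-- A pair consisting of the longest elements of the Weyl groups of `Φ` and of `Φ_p`, characterized
by their effect on heights. -/
structure IsLongestPair (p : b.support) (w₀ w₁ : P.weylGroup) : Prop where
  coheight_left (i : ι) : coheight b (w₀ • i) = -coheight b i
  level_right (i : ι) : level b p (w₁ • i) = level b p i
  coheight_right (i : ι) : coheight b (w₁ • i) = centerConst b p * level b p i - coheight b i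

theorem exists_isLongestPair (p : b.support) : ∃ w₀ w₁, IsLongestPair b p w₀ w₁ := by
  obtain ⟨w₀, h₀⟩ := exists_longest_weylGroup b
  obtain ⟨w₁, h₁⟩ := exists_longest_parabolic b p
  exact ⟨w₀, w₁, h₀, fun i => (h₁ i).1, fun i => (h₁ i).2⟩

theorem not_isPos_iff (i : ι) : ¬ b.IsPos i ↔ coheight b i < 0 := by
  rw [← isPos_negIdx, isPos_iff_coheight_pos, coheight_negIdx, neg_pos]

theorem mem_inversions {w : P.weylGroup} {i : ι} :
    i ∈ inversions b w ↔ b.IsPos i ∧ ¬ b.IsPos (w • i) := by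
  simp [inversions]

theorem level_pos_iff {p : b.support} {i : ι} (h : level b p i ≠ 0) :
    0 < level b p i ↔ b.IsPos i := by
  constructor
  · intro h1
    by_contra hn
    rw [← isPos_negIdx] at hn
    have := level_nonneg b p hn
    rw [level_negIdx] at this
    linarith
  · exact fun h1 => lt_of_le_of_ne (level_nonneg b p h1) h.symm

namespace IsLongestPair

variable {b} {p : b.support} {w₀ w₁ : P.weylGroup} (H : IsLongestPair b p w₀ w₁)

include H

theorem isPos_left (i : ι) : b.IsPos (w₀ • i) ↔ ¬ b.IsPos i := by
  rw [isPos_iff_coheight_pos, H.coheight_left, not_isPos_iff, neg_pos]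

/-- The sign of a nonzero level decides positivity, and `w₁` preserves levels. -/
theorem isPos_right {i : ι} (hi : level b p i ≠ 0) : b.IsPos (w₁ • i) ↔ b.IsPos i := by
  rw [← level_pos_iff b hi, ← H.level_right, level_pos_iff b (by rwa [H.level_right])]

theorem isPos_right_of_eq {i : ι} (hi : level b p i = 0) : b.IsPos (w₁ • i) ↔ ¬ b.IsPos i := by
  rw [isPos_iff_coheight_pos, H.coheight_right, hi, not_isPos_iff, mul_zero, zero_sub, neg_pos]

theorem isPos_mul (w : P.weylGroup) (i : ι) :
    b.IsPos ((w₀ * w * w₁) • i) ↔ ¬ b.IsPos (w • w₁ • i) := by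
  rw [mul_smul, mul_smul, H.isPos_left]

theorem linePairing_neg (s : ℂ) (i : ι) :
    linePairing b p (-s - centerConst b p) i = -linePairing b p s (w₁ • i) := by
  simp only [linePairing, H.level_right, H.coheight_right]
  push_cast
  ring

theorem linePairing_negIdx (s : ℂ) (i : ι) :
    linePairing b p s (negIdx P (w₁ • i)) = linePairing b p (-s - centerConst b p) i := by
  rw [WengZeta.linePairing_negIdx, H.linePairing_neg]

theorem leviSimple_negIdx (i : ι) :
    LeviSimple b p (negIdx P (w₁ • i)) ↔ LeviSimple b p i := by
  rw [leviSimple_iff, leviSimple_iff, level_negIdx, coheight_negIdx, H.level_right,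
    H.coheight_right, neg_eq_zero]
  refine and_congr_left fun h => ?_
  rw [h]
  simp

omit H in
theorem negIdx_smul_bijective (w : P.weylGroup) :
    Function.Bijective fun i => negIdx P (w • i) :=
  (Function.Involutive.bijective (f := negIdx P) negIdx_negIdx).comp (MulAction.bijective w)

/-- The map `i ↦ -w₁ i` permutes `Δ_p`, and `w₀ w w₁ i` has the same height as `w (-w₁ i)`.
Admissibility depends only on such heights. -/
theorem admissible_mul_iff (w : P.weylGroup) :
    Admissible b p (w₀ * w * w₁) ↔ Admissible b p w := by
  have key (v : P.weylGroup) : Admissible b p v ↔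
      ∀ i, LeviSimple b p i → coheight b (v • i) = 1 ∨ coheight b (v • i) < 0 := by
    simp only [Admissible, mem_support_iff_coheight, not_isPos_iff]
    exact ⟨fun h i hi => h ⟨i, hi.1⟩ fun e => hi.2 (congrArg Subtype.val e),
      fun h k hk => h k ⟨k.2, fun e => hk (Subtype.ext e)⟩⟩
  rw [key, key]
  conv_rhs => rw [(negIdx_smul_bijective w₁).surjective.forall]
  refine forall_congr' fun i => ?_
  rw [H.leviSimple_negIdx, smul_negIdx, coheight_negIdx, mul_smul, mul_smul, H.coheight_left]

-- At level zero `i ↦ -w₁ i` matches inversions of `w₀ w w₁` with inversions of `w` and keeps the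
-- argument. At nonzero level `i ↦ w₁ i` matches them with non-inversions of `w` and negates the
-- argument. The predicate `Q` covers both the numerator, without `Δ_p`, and the full denominator.
open scoped Classical in
theorem prod_inversions_mul (w : P.weylGroup) (Q : ι → Prop) [DecidablePred Q]
    (hQ : ∀ i, Q (negIdx P (w₁ • i)) ↔ Q i) (hQ0 : ∀ i, ¬ Q i → level b p i = 0) (s : ℂ)
    (f : ℂ → ℂ) :
    ∏ i ∈ inversions b (w₀ * w * w₁) with Q i, f (linePairing b p (-s - centerConst b p) i) =
      (∏ i ∈ inversions b w with Q i ∧ level b p i = 0, f (linePairing b p s i)) *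
      ∏ i : ι with (b.IsPos i ∧ level b p i ≠ 0) ∧ b.IsPos (w • i), f (-linePairing b p s i) := by
  rw [← Finset.prod_filter_mul_prod_filter_not _ (fun i => level b p i = 0)]
  congr 1
  · refine Finset.prod_bijective _ (negIdx_smul_bijective w₁) (fun i => ?_) fun i _ => ?_
    · simp only [Finset.mem_filter, mem_inversions, level_negIdx, H.level_right, neg_eq_zero, hQ,
        and_assoc]
      by_cases h : level b p i = 0
      · rw [isPos_negIdx, H.isPos_right_of_eq h, H.isPos_mul, smul_negIdx, isPos_negIdx]
        tauto
      · tauto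
    · rw [H.linePairing_negIdx]
  · refine Finset.prod_bijective _ (MulAction.bijective w₁) (fun i => ?_) fun i _ => ?_
    · simp only [Finset.mem_filter, mem_inversions, Finset.mem_univ, true_and, H.level_right]
      by_cases h : level b p i = 0
      · simp [h]
      · rw [H.isPos_mul, H.isPos_right h]
        have := hQ0 i
        tauto
    · rw [H.linePairing_neg]

omit H in
open scoped Classical in
theorem prod_inversions_eq (w : P.weylGroup) (Q : ι → Prop) [DecidablePred Q]
    (hQ0 : ∀ i, ¬ Q i → level b p i = 0) (f : ι → ℂ) :
    ∏ i ∈ inversions b w with Q i, f i =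
      (∏ i ∈ inversions b w with Q i ∧ level b p i = 0, f i) *
      ∏ i : ι with (b.IsPos i ∧ level b p i ≠ 0) ∧ ¬ b.IsPos (w • i), f i := by
  rw [← Finset.prod_filter_mul_prod_filter_not _ (fun i => level b p i = 0), Finset.filter_filter,
    Finset.filter_filter]
  congr 1
  refine Finset.prod_congr ?_ fun _ _ => rfl
  ext i
  simp only [Finset.mem_filter, mem_inversions, Finset.mem_univ, true_and]
  have := hQ0 i
  tauto

-- The map `i ↦ -w₀⁻¹ i` permutes the simple roots and matches the factors one by one.
open scoped Classical in
theorem prod_simple_mul (w : P.weylGroup) (s : ℂ) :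
    ∏ i ∈ b.support with ¬ LeviSimple b p ((w₀ * w * w₁)⁻¹ • i),
      (linePairing b p (-s - centerConst b p) ((w₀ * w * w₁)⁻¹ • i) - 1)⁻¹ =
    ∏ i ∈ b.support with ¬ LeviSimple b p (w⁻¹ • i), (linePairing b p s (w⁻¹ • i) - 1)⁻¹ := by
  have h (i : ι) : w⁻¹ • negIdx P (w₀⁻¹ • i) = negIdx P (w₁ • (w₀ * w * w₁)⁻¹ • i) := by
    rw [smul_negIdx]
    simp only [mul_inv_rev, mul_smul, smul_inv_smul]
  have h' (i : ι) : coheight b (w₀⁻¹ • i) = -coheight b i := by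
    have := H.coheight_left (w₀⁻¹ • i)
    rw [smul_inv_smul] at this
    rw [this, neg_neg]
  refine Finset.prod_bijective _ (negIdx_smul_bijective w₀⁻¹) (fun i => ?_) fun i _ => ?_
  · rw [Finset.mem_filter, Finset.mem_filter, h, H.leviSimple_negIdx, mem_support_iff_coheight,
      mem_support_iff_coheight, coheight_negIdx, h', neg_neg]
  · rw [h, H.linePairing_negIdx]

/-- At nonzero level the new term has `ξ(x + 1) / ξ(x)` for each non-inversion of `w`, and the old
one has `ξ(x) / ξ(x + 1)` for each inversion. Their quotient runs over all positive roots of nonzero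
level, hence does not depend on `w`. -/
theorem residueTerm_mul {s : ℂ} (hs : Generic b p s) (w : P.weylGroup) :
    residueTerm b p (w₀ * w * w₁) (-s - centerConst b p) =
      unipotentFactor b p s * residueTerm b p w s := by
  classical
  have hxi (z : ℂ) : completedRiemannZeta (-z) = completedRiemannZeta (z + 1) := by
    rw [← completedRiemannZeta_one_sub]
    congr 1
    ring
  have hxi' (z : ℂ) : completedRiemannZeta (-z + 1) = completedRiemannZeta z := by
    rw [← completedRiemannZeta_one_sub z]
    congr 1
    ring
  have hL : ∀ i, ¬ ¬ LeviSimple b p i → level b p i = 0 := fun i hi =>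
    ((leviSimple_iff b p i).1 (not_not.1 hi)).2
  have e1 := H.prod_inversions_mul w (fun i => ¬ LeviSimple b p i)
    (fun i => (H.leviSimple_negIdx i).not) hL s completedRiemannZeta
  have e2 := prod_inversions_eq w (fun i => ¬ LeviSimple b p i) hL
    fun i => completedRiemannZeta (linePairing b p s i)
  have e3 := H.prod_inversions_mul w (fun _ => True) (fun i => Iff.rfl) (by simp) s
    fun z => (completedRiemannZeta (z + 1))⁻¹
  have e4 := prod_inversions_eq (p := p) w (fun _ => True) (by simp)
    fun i => (completedRiemannZeta (linePairing b p s i + 1))⁻¹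
  rw [Finset.filter_true] at e3 e4
  have e5 := Finset.prod_filter_mul_prod_filter_not
    (Finset.univ.filter fun i => b.IsPos i ∧ level b p i ≠ 0) (fun i => b.IsPos (w • i))
    fun i => completedRiemannZeta (linePairing b p s i + 1) /
      completedRiemannZeta (linePairing b p s i)
  rw [Finset.filter_filter, Finset.filter_filter] at e5
  have e6 : (∏ i : ι with (b.IsPos i ∧ level b p i ≠ 0) ∧ ¬ b.IsPos (w • i),
      completedRiemannZeta (linePairing b p s i + 1) / completedRiemannZeta (linePairing b p s i)) *
      ((∏ i : ι with (b.IsPos i ∧ level b p i ≠ 0) ∧ ¬ b.IsPos (w • i),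
        completedRiemannZeta (linePairing b p s i)) *
      ∏ i : ι with (b.IsPos i ∧ level b p i ≠ 0) ∧ ¬ b.IsPos (w • i),
        (completedRiemannZeta (linePairing b p s i + 1))⁻¹) = 1 := by
    rw [← Finset.prod_mul_distrib, ← Finset.prod_mul_distrib]
    refine Finset.prod_eq_one fun i hi => ?_
    obtain ⟨h1, h2⟩ := hs i (Finset.mem_filter.1 hi).2.1.2
    have := h1.2.2
    have := h2.2.2
    field_simp
  simp only [hxi, hxi'] at e1 e3
  have e7 : ∀ x a c u v n m k : ℂ, n * (m * k) = 1 →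
      x * (a * u) * (c * v) = u * v * n * (x * (a * m) * (c * k)) := by
    intro x a c u v n m k h
    linear_combination (-(x * a * u * c * v)) * h
  rw [residueTerm, residueTerm, H.prod_simple_mul, e1, e2, e3, e4, unipotentFactor, ← e5,
    e7 _ _ _ _ _ _ _ _ e6]
  simp only [div_eq_mul_inv, Finset.prod_mul_distrib]

theorem residueSum_neg {s : ℂ} (hs : Generic b p s) :
    residueSum b p (-s - centerConst b p) = unipotentFactor b p s * residueSum b p s := by
  classical
  rw [residueSum, residueSum, Finset.mul_sum]
  symm
  refine Finset.sum_bijective (fun w => w₀ * w * w₁)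
    ((Group.mulRight_bijective w₁).comp (Group.mulLeft_bijective w₀)) (fun w => ?_) fun w _ =>
      (H.residueTerm_mul hs w).symm
  simp only [Finset.mem_filter, Finset.mem_univ, true_and, H.admissible_mul_iff]

end IsLongestPair

end FunctionalEquation

/-! ### Symmetry of the minimal factor by counting inversions -/

section MinimalFactor

open Filter

/-- A finite product of values of a function as a product over all values of the argument. -/
theorem prod_comp_eq_finprod {I K : Type*} (S : Finset I) (g : I → K) (f : K → ℂ) :
    ∏ i ∈ S, f (g i) = ∏ᶠ k, f k ^ Set.ncard {i | i ∈ S ∧ g i = k} := by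
  classical
  have h (k : K) : Set.ncard {i | i ∈ S ∧ g i = k} = (S.filter fun i => g i = k).card := by
    rw [← Set.ncard_coe_finset]
    congr 1
    ext i
    simp
  rw [Finset.prod_comp, finprod_eq_prod_of_mulSupport_subset (s := S.image g)]
  · simp only [h]
  · intro k hk
    by_contra hn
    refine hk ?_
    simp only [h]
    rw [Finset.card_eq_zero.2, pow_zero]
    refine Finset.filter_eq_empty_iff.2 fun i hi hik => hn ?_
    rw [← hik]
    exact_mod_cast Finset.mem_image_of_mem g hi

theorem finite_setOf_ncard_fiber_ne_zero {I K : Type*} [Finite I] (Q : I → Prop) (g : I → K) :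
    {k | Set.ncard {i | Q i ∧ g i = k} ≠ 0}.Finite := by
  refine (Set.finite_range g).subset fun k hk => ?_
  obtain ⟨i, -, hi⟩ := Set.nonempty_of_ncard_ne_zero hk
  exact ⟨i, hi⟩

variable {ι V V' : Type*} [Fintype ι] [AddCommGroup V] [Module ℝ V]
  [AddCommGroup V'] [Module ℝ V'] {P : RootPairing ι ℝ V V'} [P.IsRootSystem]
  [P.IsCrystallographic] [P.IsReduced] (b : P.Base)

/-- The pair `(⟨λ_p, α^∨⟩, Ht α^∨)` of integers. -/
def bidegree (p : b.support) (i : ι) : ℤ × ℤ :=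
  ((exists_level_eq_int b p i).choose, b.flip.height i)

theorem bidegree_eq_iff {p : b.support} {i : ι} {k h : ℤ} :
    bidegree b p i = (k, h) ↔ level b p i = k ∧ coheight b i = h := by
  have h1 := (exists_level_eq_int b p i).choose_spec
  rw [bidegree, Prod.mk.injEq, coheight_eq_height]
  refine and_congr ⟨fun h => by rw [h1, h], fun h => ?_⟩ (by norm_cast)
  exact_mod_cast h1.symm.trans h

theorem linePairing_eq (p : b.support) (s : ℂ) (i : ι) :
    linePairing b p s i = (bidegree b p i).1 * s + (bidegree b p i).2 := by
  obtain ⟨h1, h2⟩ := (bidegree_eq_iff b (p := p) (i := i)).1 rfl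
  rw [linePairing, h1, h2]
  norm_cast

/-- The number of inversions of `w` of given level and height. -/
def inversionCount (p : b.support) (w : P.weylGroup) (k h : ℤ) : ℕ :=
  Set.ncard {i : ι | i ∈ inversions b w ∧ bidegree b p i = (k, h)}

/-- The number of positive roots of given nonzero level and height. -/
def posCount (p : b.support) (k h : ℤ) : ℕ :=
  Set.ncard {i : ι | (b.IsPos i ∧ level b p i ≠ 0) ∧ bidegree b p i = (k, h)}

theorem denCount_eq (p : b.support) (w : P.weylGroup) (k h : ℤ) :
    denCount b p w k h = inversionCount b p w k (h - 1) := by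
  unfold denCount inversionCount
  congr 1
  ext i
  simp only [Set.mem_ofPred_eq, bidegree_eq_iff, level]
  push_cast
  rw [eq_sub_iff_add_eq]

/-- The excluded roots `Δ_p` all have level zero. -/
theorem numCount_eq (p : b.support) (w : P.weylGroup) {k : ℤ} (hk : k ≠ 0) (h : ℤ) :
    numCount b p w k h = inversionCount b p w k h := by
  unfold numCount inversionCount
  congr 1
  ext i
  simp only [Set.mem_ofPred_eq, bidegree_eq_iff, mem_support_ne_iff]
  have : level b p i = k → level b p i ≠ 0 := fun h => by rw [h]; exact_mod_cast hk
  unfold level at *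
  tauto

theorem admissible_one (p : b.support) : Admissible b p 1 := fun k _ => by simp

theorem inversionCount_one (p : b.support) (k h : ℤ) : inversionCount b p 1 k h = 0 := by
  simp [inversionCount, mem_inversions]

theorem minimalExponent_spec (p : b.support) (k h : ℤ) {w : P.weylGroup} (hw : Admissible b p w) :
    denCount b p w k h ≤ numCount b p w k h + minimalExponent b p k h := by
  -- The infimum of the empty set would be 0, so an explicit bound is required: the number of roots
  -- suffices.
  have hne : {m : ℕ | ∀ w : P.weylGroup, Admissible b p w →
      denCount b p w k h ≤ numCount b p w k h + m}.Nonempty :=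
    ⟨Nat.card ι, fun w _ => (Set.ncard_le_card _).trans (Nat.le_add_left _ _)⟩
  exact Nat.sInf_mem hne w hw

namespace IsLongestPair

variable {b} {p : b.support} {w₀ w₁ : P.weylGroup} (H : IsLongestPair b p w₀ w₁)

include H

theorem bidegree_smul {c : ℤ} (hc : centerConst b p = c) (i : ι) (k h : ℤ) :
    bidegree b p (w₁ • i) = (k, c * k - h) ↔ bidegree b p i = (k, h) := by
  rw [bidegree_eq_iff, bidegree_eq_iff, H.level_right, H.coheight_right]
  refine and_congr_right fun hi => ?_
  rw [hi, hc]
  push_cast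
  exact sub_right_inj

theorem posCount_symm {c : ℤ} (hc : centerConst b p = c) (k h : ℤ) :
    posCount b p k (c * k - h) = posCount b p k h := by
  symm
  refine Set.ncard_congr (fun i _ => w₁ • i) ?_ (fun i j _ _ h => MulAction.injective w₁ h) ?_
  · rintro i ⟨⟨h1, h2⟩, h3⟩
    exact ⟨⟨(H.isPos_right h2).2 h1, by rwa [H.level_right]⟩, (H.bidegree_smul hc i k h).2 h3⟩
  · rintro i ⟨⟨h1, h2⟩, h3⟩
    have hl : level b p (w₁⁻¹ • i) ≠ 0 := by rwa [← H.level_right, smul_inv_smul]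
    refine ⟨w₁⁻¹ • i, ⟨⟨?_, hl⟩, ?_⟩, by simp⟩
    · rwa [← H.isPos_right hl, smul_inv_smul]
    · rwa [← H.bidegree_smul hc, smul_inv_smul]

/-- Through `w₁`, inversions of `w₀ w w₁` of height `c k - h` become non-inversions of `w` of height
`h`. Together with the inversions they exhaust the positive roots of this bidegree. -/
theorem inversionCount_mul {c : ℤ} (hc : centerConst b p = c) (w : P.weylGroup) {k : ℤ}
    (hk : k ≠ 0) (h : ℤ) :
    inversionCount b p (w₀ * w * w₁) k (c * k - h) + inversionCount b p w k h =
      posCount b p k h := by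
  have hlev {i : ι} {h : ℤ} (hi : bidegree b p i = (k, h)) : level b p i ≠ 0 := by
    rw [((bidegree_eq_iff b).1 hi).1]
    exact_mod_cast hk
  have h1 : inversionCount b p (w₀ * w * w₁) k (c * k - h) =
      Set.ncard {i : ι | (b.IsPos i ∧ b.IsPos (w • i)) ∧ bidegree b p i = (k, h)} := by
    have e : c * k - (c * k - h) = h := by ring
    refine Set.ncard_congr (fun i _ => w₁ • i) ?_ (fun i j _ _ h => MulAction.injective w₁ h) ?_
    · rintro i ⟨h1, h2⟩
      rw [mem_inversions, H.isPos_mul, not_not] at h1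
      refine ⟨⟨(H.isPos_right (hlev h2)).2 h1.1, h1.2⟩, ?_⟩
      rw [← e]
      exact (H.bidegree_smul hc i k _).2 h2
    · rintro i ⟨⟨h1, h2⟩, h3⟩
      rw [← e] at h3
      have h4 := (H.bidegree_smul hc (w₁⁻¹ • i) k (c * k - h)).1 (by rwa [smul_inv_smul])
      refine ⟨w₁⁻¹ • i, ⟨?_, h4⟩, by simp⟩
      rw [mem_inversions, H.isPos_mul, not_not, ← H.isPos_right (hlev h4), smul_inv_smul]
      exact ⟨h1, h2⟩
  rw [h1, inversionCount, posCount, ← Set.ncard_union_eq]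
  · congr 1
    ext i
    simp only [Set.mem_union, Set.mem_ofPred_eq, mem_inversions]
    have := hlev (i := i) (h := h)
    tauto
  · rw [Set.disjoint_left]
    rintro i ⟨⟨-, h1⟩, -⟩ ⟨h2, -⟩
    exact ((mem_inversions b).1 h2).2 h1

/-- With `N_w` the inversion count, the exponent at `(k, h)` is the maximum over admissible `w` of
`N_w(k, h - 1) - N_w(k, h)`. Replacing `w` by `w₀ w w₁` complements both counts, which shifts this
difference by an amount independent of `w`. -/
theorem minimalExponent_add_le {c : ℤ} (hc : centerConst b p = c) {k : ℤ} (hk : k ≠ 0) (h : ℤ) :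
    minimalExponent b p k h + posCount b p k h ≤
      minimalExponent b p k (c * k - h + 1) + posCount b p k (h - 1) := by
  have key (w : P.weylGroup) (hw : Admissible b p w) :
      inversionCount b p (w₀ * w * w₁) k (c * k - h) ≤
        inversionCount b p (w₀ * w * w₁) k (c * k - (h - 1)) +
          minimalExponent b p k (c * k - h + 1) := by
    have := minimalExponent_spec b p k (c * k - h + 1) ((H.admissible_mul_iff w).2 hw)
    rw [denCount_eq, numCount_eq b p _ hk, add_sub_cancel_right] at this
    rwa [show c * k - (h - 1) = c * k - h + 1 by ring]
  have h1 := H.inversionCount_mul hc 1 hk h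
  have h2 := H.inversionCount_mul hc 1 hk (h - 1)
  -- The identity has no inversions, so this case shows that the truncated subtraction below is a
  -- genuine one.
  have h3 := key 1 (admissible_one b p)
  rw [inversionCount_one] at h1 h2
  have h4 : minimalExponent b p k h ≤
      minimalExponent b p k (c * k - h + 1) + posCount b p k (h - 1) - posCount b p k h := by
    refine Nat.sInf_le fun w hw => ?_
    rw [denCount_eq, numCount_eq b p _ hk]
    have h5 := H.inversionCount_mul hc w hk h
    have h6 := H.inversionCount_mul hc w hk (h - 1)
    have h7 := key w hw
    omega
  omega

/-- The reflection `h ↦ c k - h + 1` is an involution, so the inequality applied at the reflected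
index, with the symmetry of `posCount`, is the reverse inequality. -/
theorem minimalExponent_add {c : ℤ} (hc : centerConst b p = c) {k : ℤ} (hk : k ≠ 0) (h : ℤ) :
    minimalExponent b p k (c * k - h + 1) + posCount b p k (h - 1) =
      minimalExponent b p k h + posCount b p k h := by
  refine le_antisymm ?_ (H.minimalExponent_add_le hc hk h)
  have h1 := H.minimalExponent_add_le hc hk (c * k - h + 1)
  have h2 := H.posCount_symm hc k (h - 1)
  have h3 := H.posCount_symm hc k h
  rw [show c * k - (c * k - h + 1) + 1 = h by ring, show c * k - h + 1 - 1 = c * k - h by ring,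
    show c * k - h + 1 = c * k - (h - 1) by ring, h2, h3] at h1
  rwa [show c * k - h + 1 = c * k - (h - 1) by ring]

end IsLongestPair

theorem posCount_zero (p : b.support) (h : ℤ) : posCount b p 0 h = 0 := by
  rw [posCount, Set.ncard_eq_zero]
  ext i
  simp only [Set.mem_ofPred_eq, bidegree_eq_iff, Int.cast_zero, Set.mem_empty_iff_false]
  tauto

theorem finite_minimalExponent (p : b.support) :
    {kh : ℤ × ℤ | minimalExponent b p kh.1 kh.2 ≠ 0}.Finite := by
  refine (Set.finite_range fun i => bidegree b p i + (0, 1)).subset ?_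
  rintro ⟨k, h⟩ hkh
  by_contra hn
  refine hkh (Nat.le_zero.1 (Nat.sInf_le fun w _ => ?_))
  rw [denCount_eq, inversionCount, (Set.ncard_eq_zero (Set.toFinite _)).2]
  · exact Nat.zero_le _
  · refine Set.eq_empty_of_forall_notMem fun i hi => hn ⟨i, ?_⟩
    simp only
    rw [hi.2]
    ext <;> simp

/-- The reflection of the indices of the `ξ`-factors under `s ↦ -c - s`. -/
def indexReflection (c : ℤ) (kh : ℤ × ℤ) : ℤ × ℤ :=
  if kh.1 = 0 then kh else (kh.1, c * kh.1 - kh.2 + 1)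

theorem indexReflection_involutive (c : ℤ) : Function.Involutive (indexReflection c) := by
  rintro ⟨k, h⟩
  by_cases hk : k = 0
  · simp [indexReflection, hk]
  · simp only [indexReflection, hk, if_false]
    ext
    · rfl
    · simp
      ring

theorem completedRiemannZeta_indexReflection (c : ℤ) (s : ℂ) (kh : ℤ × ℤ) :
    completedRiemannZeta (kh.1 * (-s - c) + kh.2) =
      completedRiemannZeta ((indexReflection c kh).1 * s + (indexReflection c kh).2) := by
  obtain ⟨k, h⟩ := kh
  by_cases hk : k = 0
  · simp [indexReflection, hk]
  · rw [← completedRiemannZeta_one_sub]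
    simp only [indexReflection, hk, if_false]
    congr 1
    push_cast
    ring

/-- After clearing the denominator of the unipotent factor, both sides are products of powers of the
`ξ(k s + h)`, and the exponents agree by `minimalExponent_add`. Factors with `k = 0` are constants
and stay fixed. -/
theorem minimalFactor_mul_unipotentFactor {p : b.support} {s : ℂ} (hs : Generic b p s) :
    minimalFactor b p (-s - centerConst b p) * unipotentFactor b p s = minimalFactor b p s := by
  classical
  obtain ⟨w₀, w₁, H⟩ := exists_isLongestPair b p
  obtain ⟨c, hc⟩ := exists_centerConst_eq_int b p
  set f : ℤ × ℤ → ℂ := fun kh => completedRiemannZeta (kh.1 * s + kh.2) with hf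
  set S : Finset ι := {i | b.IsPos i ∧ level b p i ≠ 0} with hS
  have hmemS (i : ι) : i ∈ S ↔ b.IsPos i ∧ level b p i ≠ 0 := by simp [hS]
  have h1 : minimalFactor b p (-s - centerConst b p) =
      ∏ᶠ kh, f kh ^ minimalExponent b p (indexReflection c kh).1 (indexReflection c kh).2 := by
    rw [minimalFactor, ← finprod_comp _ (indexReflection_involutive c).bijective]
    refine finprod_congr fun kh => ?_
    rw [hc, Complex.ofReal_intCast, completedRiemannZeta_indexReflection,
      indexReflection_involutive c kh]
  have h2 : ∏ i ∈ S, completedRiemannZeta (linePairing b p s i + 1) =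
      ∏ᶠ kh : ℤ × ℤ, f kh ^ posCount b p kh.1 (kh.2 - 1) := by
    have := prod_comp_eq_finprod S (fun i => bidegree b p i + (0, 1)) f
    convert this using 1
    · refine Finset.prod_congr rfl fun i _ => ?_
      rw [linePairing_eq]
      simp [hf, add_assoc]
    · refine finprod_congr fun kh => ?_
      rw [posCount]
      congr 2
      ext i
      simp only [Set.mem_ofPred_eq, hmemS]
      refine and_congr_right fun _ => ?_
      simp [Prod.ext_iff, eq_sub_iff_add_eq]
  have h3 : ∏ i ∈ S, completedRiemannZeta (linePairing b p s i) =
      ∏ᶠ kh : ℤ × ℤ, f kh ^ posCount b p kh.1 kh.2 := by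
    have := prod_comp_eq_finprod S (fun i => bidegree b p i) f
    convert this using 1
    · exact Finset.prod_congr rfl fun i _ => by rw [linePairing_eq]
    · refine finprod_congr fun kh => ?_
      simp only [posCount, hmemS]
  have h4 : ∏ i ∈ S, completedRiemannZeta (linePairing b p s i) ≠ 0 :=
    Finset.prod_ne_zero_iff.2 fun i hi => (hs i ((hmemS i).1 hi).2).1.2.2
  have hfin {e : ℤ × ℤ → ℕ} (he : {kh | e kh ≠ 0}.Finite) :
      (Function.mulSupport fun kh => f kh ^ e kh).Finite :=
    he.subset fun kh hkh he0 => hkh (by simp [he0])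
  have hpos : {kh : ℤ × ℤ | posCount b p kh.1 kh.2 ≠ 0}.Finite :=
    finite_setOf_ncard_fiber_ne_zero _ _
  have hinj : Function.Injective fun kh : ℤ × ℤ => (kh.1, kh.2 - 1) := by
    rintro ⟨a, a'⟩ ⟨d, d'⟩ h
    simpa using h
  rw [unipotentFactor, Finset.prod_div_distrib, ← hS, ← mul_div_assoc, div_eq_iff h4, h1, h2, h3,
    minimalFactor, ← finprod_mul_distrib, ← finprod_mul_distrib]
  · refine finprod_congr fun kh => ?_
    rw [← pow_add, ← pow_add]
    congr 1
    obtain ⟨k, h⟩ := kh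
    by_cases hk : k = 0
    · subst hk
      simp [indexReflection, posCount_zero]
    · simpa [indexReflection, hk] using H.minimalExponent_add hc hk h
  · exact hfin (finite_minimalExponent b p)
  · exact hfin hpos
  · exact hfin ((finite_minimalExponent b p).preimage
      (indexReflection_involutive c).injective.injOn)
  · exact hfin (hpos.preimage hinj.injOn)

end MinimalFactor

/-! ### Invariance under automorphisms of the Dynkin diagram -/

section DiagramAutomorphisms

variable {ι V V' : Type*} [AddCommGroup V] [Module ℝ V]
  [AddCommGroup V'] [Module ℝ V'] {P : RootPairing ι ℝ V V'}

theorem aut_pairing_smul (f : P.Aut) (v : V) (i : ι) :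
    P.toLinearMap (f • v) (P.coroot (f • i)) = P.toLinearMap v (P.coroot i) :=
  aut_pairing f v i

theorem aut_smul_root (f : P.Aut) (i : ι) : f • P.root i = P.root (f • i) :=
  RootPairing.Hom.root_weightMap_apply P P i f.toHom

theorem pairing_aut (f : P.Aut) (i j : ι) : P.pairing (f • i) (f • j) = P.pairing i j := by
  rw [← RootPairing.root_coroot_eq_pairing, ← aut_smul_root]
  exact aut_pairing f _ j

theorem aut_conj_reflection (f : P.Aut) (i : ι) :
    f * RootPairing.Equiv.reflection P i * f⁻¹ = RootPairing.Equiv.reflection P (f • i) := by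
  apply RootPairing.Equiv.weightHom_injective P
  ext v
  change f • (RootPairing.Equiv.reflection P i • f⁻¹ • v) = P.reflection (f • i) v
  rw [RootPairing.Equiv.reflection_smul, RootPairing.reflection_apply,
    RootPairing.reflection_apply, smul_sub, smul_inv_smul, smul_comm, aut_smul_root]
  congr 2
  have := aut_pairing_smul f (f⁻¹ • v) i
  rw [smul_inv_smul] at this
  exact this.symm

theorem aut_conj_mem_weylGroup (f : P.Aut) {w : P.Aut} (hw : w ∈ P.weylGroup) :
    f * w * f⁻¹ ∈ P.weylGroup := by
  have h : P.weylGroup ≤ P.weylGroup.comap (MulAut.conj f).toMonoidHom := by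
    refine (Subgroup.closure_le _).2 ?_
    rintro _ ⟨i, rfl⟩
    change f * RootPairing.Equiv.reflection P i * f⁻¹ ∈ P.weylGroup
    rw [aut_conj_reflection]
    exact P.reflection_mem_weylGroup _
  exact h hw

/-- Conjugation by an automorphism of the root system, as a map of the Weyl group to itself. -/
def weylConj (f : P.Aut) (w : P.weylGroup) : P.weylGroup :=
  ⟨f * w * f⁻¹, aut_conj_mem_weylGroup f w.2⟩

theorem weylConj_smul (f : P.Aut) (w : P.weylGroup) (i : ι) :
    weylConj f w • f • i = f • w • i := by
  change (f * (w : P.Aut) * f⁻¹) • f • i = f • (w : P.Aut) • i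
  simp only [mul_smul, inv_smul_smul]

theorem weylConj_inv_smul (f : P.Aut) (w : P.weylGroup) (i : ι) :
    (weylConj f w)⁻¹ • f • i = f • w⁻¹ • i := by
  rw [inv_smul_eq_iff, weylConj_smul, smul_inv_smul]

theorem weylConj_bijective [Finite ι] [P.IsRootSystem] (f : P.Aut) :
    Function.Bijective (weylConj f) := by
  refine Finite.injective_iff_bijective.1 fun w w' h => ?_
  exact Subtype.ext (mul_left_cancel (mul_right_cancel (congrArg Subtype.val h)))

theorem ncard_aut (f : P.Aut) {A B : Set ι} (h : ∀ i, f • i ∈ B ↔ i ∈ A) : B.ncard = A.ncard := by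
  symm
  refine Set.ncard_congr (fun i _ => f • i) (fun i hi => (h i).2 hi)
    (fun i j _ _ h => MulAction.injective f h) fun i hi => ⟨f⁻¹ • i, ?_, by simp⟩
  rwa [← h, smul_inv_smul]

variable [Fintype ι] [P.IsRootSystem] [P.IsCrystallographic] [P.IsReduced] (b : P.Base)

/-- The Cartan matrix determines the root system together with its base. -/
theorem exists_aut_of_mem_dynkinAut {e : Equiv.Perm b.support} (he : e ∈ dynkinAut b) :
    ∃ f : P.Aut, ∀ k : b.support, f • (k : ι) = e k := by
  refine ⟨b.equivOfCartanMatrixEq b e he, fun k => P.root.injective ?_⟩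
  rw [← aut_smul_root]
  change b.toWeightBasis.equiv b.toWeightBasis e (P.root k) = _
  rw [← b.toWeightBasis_apply, Module.Basis.equiv_apply, b.toWeightBasis_apply]

variable {b} {e : Equiv.Perm b.support} {f : P.Aut} (hf : ∀ k : b.support, f • (k : ι) = e k)

include hf

/-- A weight is determined by its pairings with the simple coroots. This is applied to `ρ` and to
the fundamental weights. -/
theorem pairing_aut_eq {u v : V}
    (h : ∀ k : b.support, P.toLinearMap u (P.coroot (e k)) = P.toLinearMap v (P.coroot k)) (i : ι) :
    P.toLinearMap u (P.coroot (f • i)) = P.toLinearMap v (P.coroot i) := by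
  have h1 (j : ι) : P.toLinearMap u (P.coroot (f • j)) = P.toLinearMap (f⁻¹ • u) (P.coroot j) := by
    rw [← aut_pairing_smul f (f⁻¹ • u), smul_inv_smul]
  rw [h1, pairing_eq_sum_level b, pairing_eq_sum_level b v]
  exact Finset.sum_congr rfl fun k _ => by rw [← h1, hf, h]

theorem coheight_aut (i : ι) : coheight b (f • i) = coheight b i :=
  pairing_aut_eq hf (fun k => (coheight_of_mem_support b (e k).2).trans
    (coheight_of_mem_support b k.2).symm) i

theorem level_aut (p : b.support) (i : ι) : level b (e p) (f • i) = level b p i := by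
  classical
  refine pairing_aut_eq hf (fun k => ?_) i
  simp [pairing_fundamentalWeight]

theorem isPos_aut (i : ι) : b.IsPos (f • i) ↔ b.IsPos i := by
  rw [isPos_iff_coheight_pos, isPos_iff_coheight_pos, coheight_aut hf]

theorem linePairing_aut (p : b.support) (s : ℂ) (i : ι) :
    linePairing b (e p) s (f • i) = linePairing b p s i := by
  rw [linePairing, linePairing, level_aut hf, coheight_aut hf]

theorem mem_support_aut (i : ι) : f • i ∈ b.support ↔ i ∈ b.support := by
  rw [mem_support_iff_coheight, mem_support_iff_coheight, coheight_aut hf]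

theorem leviSimple_aut (p : b.support) (i : ι) :
    LeviSimple b (e p) (f • i) ↔ LeviSimple b p i := by
  rw [leviSimple_iff, leviSimple_iff, level_aut hf, coheight_aut hf]

theorem mem_inversions_aut (w : P.weylGroup) (i : ι) :
    f • i ∈ inversions b (weylConj f w) ↔ i ∈ inversions b w := by
  rw [mem_inversions, mem_inversions, weylConj_smul, isPos_aut hf, isPos_aut hf]

theorem admissible_aut (p : b.support) (w : P.weylGroup) :
    Admissible b (e p) (weylConj f w) ↔ Admissible b p w := by
  unfold Admissible
  rw [e.surjective.forall]
  refine forall_congr' fun k => ?_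
  rw [← hf, weylConj_smul, isPos_aut hf, mem_support_aut hf, e.injective.ne_iff]

theorem residueTerm_aut (p : b.support) (w : P.weylGroup) (s : ℂ) :
    residueTerm b (e p) (weylConj f w) s = residueTerm b p w s := by
  classical
  unfold residueTerm
  refine congrArg₂ _ (congrArg₂ _ ?_ ?_) ?_
  · symm
    refine Finset.prod_bijective _ (MulAction.bijective f) (fun i => ?_) fun i _ => ?_
    · rw [Finset.mem_filter, Finset.mem_filter, weylConj_inv_smul, leviSimple_aut hf,
        mem_support_aut hf]
    · rw [weylConj_inv_smul, linePairing_aut hf]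
  · symm
    refine Finset.prod_bijective _ (MulAction.bijective f) (fun i => ?_) fun i _ => ?_
    · rw [Finset.mem_filter, Finset.mem_filter, leviSimple_aut hf, mem_inversions_aut hf]
    · rw [linePairing_aut hf]
  · symm
    refine Finset.prod_bijective _ (MulAction.bijective f)
      (fun i => (mem_inversions_aut hf w i).symm) fun i _ => ?_
    rw [linePairing_aut hf]

theorem residueSum_aut (p : b.support) (s : ℂ) : residueSum b (e p) s = residueSum b p s := by
  classical
  symm
  refine Finset.sum_bijective _ (weylConj_bijective f) (fun w => ?_) fun w _ =>
    (residueTerm_aut hf p w s).symm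
  simp only [Finset.mem_filter, Finset.mem_univ, true_and, admissible_aut hf]

theorem denCount_aut (p : b.support) (w : P.weylGroup) (k h : ℤ) :
    denCount b (e p) (weylConj f w) k h = denCount b p w k h := by
  refine ncard_aut f fun i => ?_
  have := level_aut hf p i
  unfold level at this
  simp only [Set.mem_ofPred_eq, mem_inversions_aut hf, coheight_aut hf, this]

theorem numCount_aut (p : b.support) (w : P.weylGroup) (k h : ℤ) :
    numCount b (e p) (weylConj f w) k h = numCount b p w k h := by
  refine ncard_aut f fun i => ?_
  have h1 := level_aut hf p i
  have h2 := leviSimple_aut hf p i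
  unfold level at h1
  unfold LeviSimple at h2
  simp only [Set.mem_ofPred_eq, mem_inversions_aut hf, coheight_aut hf, h1, h2]

theorem minimalFactor_aut (p : b.support) (s : ℂ) :
    minimalFactor b (e p) s = minimalFactor b p s := by
  have h (k h : ℤ) : minimalExponent b (e p) k h = minimalExponent b p k h := by
    unfold minimalExponent
    congr 1
    ext m
    simp only [Set.mem_ofPred_eq]
    rw [(weylConj_bijective f).surjective.forall]
    simp only [admissible_aut hf, denCount_aut hf, numCount_aut hf]
  simp only [minimalFactor, h]

theorem centerConst_aut (p : b.support) : centerConst b (e p) = centerConst b p := by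
  classical
  have h (q : b.support) : centerConst b q =
      2 * (1 - 1 / 2 * ∑ i : ι with b.IsPos i ∧ level b q i = 0, P.pairing i q) := by
    have h1 : P.toLinearMap (fundamentalWeight b q) (P.coroot q) = 1 := level_self b q
    rw [centerConst, map_sub, LinearMap.sub_apply, h1, weylVectorAt]
    simp [level]
    congr!
  rw [h, h]
  congr 3
  symm
  refine Finset.sum_bijective _ (MulAction.bijective f) (fun i => ?_) fun i _ => ?_
  · simp only [Finset.mem_filter, Finset.mem_univ, true_and, isPos_aut hf, level_aut hf]
  · rw [← hf, pairing_aut]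

end DiagramAutomorphisms

/-! ### Meromorphic continuation and the final identities -/

section MainTheorem

open Filter

variable {ι V V' : Type*} [Fintype ι] [AddCommGroup V] [Module ℝ V]
  [AddCommGroup V'] [Module ℝ V'] {P : RootPairing ι ℝ V V'} [P.IsRootSystem]
  [P.IsCrystallographic] [P.IsReduced] {b : P.Base}

theorem meromorphic_xi_affine (k h : ℂ) :
    Meromorphic fun s => completedRiemannZeta (k * s + h) := by
  intro s
  exact (meromorphic_completedRiemannZeta (k * s + h)).comp_analyticAt
    (g := fun s => k * s + h) (by fun_prop)

theorem meromorphic_residueSum (p : b.support) : Meromorphic (residueSum b p) := by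
  classical
  intro s
  refine MeromorphicAt.fun_sum fun w _ => ?_
  refine MeromorphicAt.mul (MeromorphicAt.mul ?_ ?_) ?_
  · refine MeromorphicAt.fun_prod fun i _ => ?_
    unfold linePairing
    fun_prop
  · exact MeromorphicAt.fun_prod fun i _ => meromorphic_xi_affine _ _ s
  · refine MeromorphicAt.fun_prod fun i _ => MeromorphicAt.inv ?_
    simp only [linePairing, add_assoc]
    exact meromorphic_xi_affine _ _ s

theorem meromorphic_minimalFactor (p : b.support) : Meromorphic (minimalFactor b p) := by
  intro s
  have h : minimalFactor b p = ∏ kh ∈ (finite_minimalExponent b p).toFinset,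
      fun s => completedRiemannZeta (kh.1 * s + kh.2) ^ minimalExponent b p kh.1 kh.2 := by
    funext s
    rw [Finset.prod_apply]
    refine finprod_eq_prod_of_mulSupport_subset _ fun kh hkh => ?_
    simp only [Set.Finite.coe_toFinset, Set.mem_ofPred_eq]
    exact fun h => hkh (by simp [h])
  rw [h]
  exact MeromorphicAt.prod fun kh _ => (meromorphic_xi_affine _ _ s).pow _

theorem zetaExpr_eventuallyEq {p : b.support} {l : List b.support} (hl : IsOrdering b p l) (z : ℂ) :
    zetaExpr b p l 0 =ᶠ[𝓝[≠] z] fun s => residueSum b p s * minimalFactor b p s := by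
  filter_upwards [eventually_generic b p z] with s hs
  rw [zetaExpr, residualPeriod_eq b hl hs]

theorem meromorphic_zetaExpr {p : b.support} {l : List b.support} (hl : IsOrdering b p l) :
    Meromorphic (zetaExpr b p l 0) := fun z =>
  ((meromorphic_residueSum p z).mul (meromorphic_minimalFactor p z)).congr
    (zetaExpr_eventuallyEq hl z).symm

theorem zetaO_eventuallyEq {p : b.support} {l : List b.support} (hl : IsOrdering b p l) (z : ℂ) :
    zetaO b p l 0 =ᶠ[𝓝[≠] z] fun s => residueSum b p s * minimalFactor b p s :=
  ((meromorphic_zetaExpr hl).meromorphicOn.toMeromorphicNFOn_eq_self_on_nhdsNE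
    (Set.mem_univ z)).trans (zetaExpr_eventuallyEq hl z)

theorem meromorphicNFAt_zetaO (p : b.support) (l : List b.support) (z : ℂ) :
    MeromorphicNFAt (zetaO b p l 0) z :=
  meromorphicNFOn_toMeromorphicNFOn _ _ (Set.mem_univ z)

/-- Both sides are in meromorphic normal form, so agreement on a punctured neighbourhood forces
agreement at the point, poles included. -/
theorem zetaO_neg {p : b.support} {l : List b.support} (hl : IsOrdering b p l) (z : ℂ) :
    zetaO b p l 0 (-z - centerConst b p) = zetaO b p l 0 z := by
  set c : ℂ := (centerConst b p : ℂ) with hc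
  have h1 : Tendsto (fun s : ℂ => -s - c) (𝓝[≠] z) (𝓝[≠] (-z - c)) := by
    refine tendsto_nhdsWithin_of_tendsto_nhds_of_eventually_within _ ?_ ?_
    · exact (Continuous.tendsto (by fun_prop) z).mono_left nhdsWithin_le_nhds
    · filter_upwards [eventually_mem_nhdsWithin] with s hs
      simpa using hs
  have h2 : (zetaO b p l 0 ∘ fun s => -s - c) =ᶠ[𝓝[≠] z] zetaO b p l 0 := by
    filter_upwards [h1.eventually (zetaO_eventuallyEq hl (-z - c)), zetaO_eventuallyEq hl z,
      eventually_generic b p z] with s h3 h4 h5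
    obtain ⟨w₀, w₁, H⟩ := exists_isLongestPair b p
    rw [Function.comp_apply, h3, h4, ← minimalFactor_mul_unipotentFactor b h5, hc,
      H.residueSum_neg h5]
    ring
  have h3 : MeromorphicNFAt (zetaO b p l 0 ∘ fun s => -s - c) z :=
    (meromorphicNFAt_zetaO p l (-z - c)).comp_analyticAt (g := fun s => -s - c) (by fun_prop)
  exact ((h3.eventuallyEq_nhdsNE_iff_eventuallyEq_nhds
    (meromorphicNFAt_zetaO p l z)).1 h2).eq_of_nhds

theorem zetaO_aut {p : b.support} {l l' : List b.support} (hl : IsOrdering b p l)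
    {e : Equiv.Perm b.support} (he : e ∈ dynkinAut b) (hl' : IsOrdering b (e p) l') :
    zetaO b p l 0 = zetaO b (e p) l' 0 := by
  obtain ⟨f, hf⟩ := exists_aut_of_mem_dynkinAut b he
  funext z
  refine (((meromorphicNFAt_zetaO p l z).eventuallyEq_nhdsNE_iff_eventuallyEq_nhds
    (meromorphicNFAt_zetaO (e p) l' z)).1 ?_).eq_of_nhds
  filter_upwards [zetaO_eventuallyEq hl z, zetaO_eventuallyEq hl' z] with s h1 h2
  rw [h1, h2, residueSum_aut hf, minimalFactor_aut hf]

/-- The shift by `(c_p + 1) / 2` turns the symmetry `z ↦ -z - c_p` into `s ↦ 1 - s`. -/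
theorem zeta_one_sub {p : b.support} {l : List b.support} (hl : IsOrdering b p l) (s : ℂ) :
    zeta b p l (1 - s) = zeta b p l s := by
  rw [zeta, zeta, ← zetaO_neg hl]
  congr 1
  ring

end MainTheorem

end WengZeta

end

theorem mainTheorem2 {ι V V' : Type*} [Fintype ι] [AddCommGroup V] [Module ℝ V]
    [AddCommGroup V'] [Module ℝ V'] (P : RootPairing ι ℝ V V') [P.IsRootSystem]
    [P.IsCrystallographic] [P.IsReduced] (b : P.Base) (p : b.support)
    (l : List b.support) (hl : WengZeta.IsOrdering b p l) :
    Meromorphic (WengZeta.zetaExpr b p l 0) ∧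
    (∀ s : ℂ, WengZeta.zeta b p l (1 - s) = WengZeta.zeta b p l s) ∧
    ∀ q ∈ MulAction.orbit (WengZeta.dynkinAut b) p,
      ∀ l' : List b.support, WengZeta.IsOrdering b q l' →
        ∀ s : ℂ, WengZeta.zeta b p l s = WengZeta.zeta b q l' s := by
  refine ⟨WengZeta.meromorphic_zetaExpr hl, WengZeta.zeta_one_sub hl, ?_⟩
  rintro q ⟨⟨e, he⟩, rfl⟩ l' hl' s
  change WengZeta.IsOrdering b (e p) l' at hl'
  change WengZeta.zeta b p l s = WengZeta.zeta b (e p) l' s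
  obtain ⟨f, hf⟩ := WengZeta.exists_aut_of_mem_dynkinAut b he
  rw [WengZeta.zeta, WengZeta.zeta, WengZeta.zetaO_aut hl he hl', WengZeta.centerConst_aut hf]
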